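/- Let $n \ge 8$ and $s$ be integers with $s^2 \equiv 1 \pmod n$ and $s \not\equiv \pm 1 \pmod n$, and let $$G_{n,s} = C_n \rtimes_s C_2 = \langle x, y \mid x^2 = y^n = 1,\ yx = xy^s \rangle .$$ A sequence over a finite group $G$ is a finite unordered list of elements of $G$ with repetition allowed; its subsequences are its sub-multisets, $\boldsymbol{\cdot}$ denotes concatenation, and $g^{[k]}$ is the sequence consisting of $k$ copies of $g$. A sequence $T$ over $G$ is a short product-one sequence if $1 \le |T| \le \exp(G)$ and the terms of $T$ can be ordered so that their product is $1$. Let $\eta(G)$ be the smallest $\ell > 0$ such that every sequence over $G$ of length at least $\ell$ has a short product-one subsequence. Then $\eta(G_{n,s}) = n+1$. Moreover, a sequence $S$ over $G_{n,s}$ of length $|S| = n$ has no short product-one subsequence if and only if there exist $\alpha, \beta \in G_{n,s}$ such that $G_{n,s} \simeq \langle \alpha, \beta \mid \alpha^2 = \beta^n = 1,\ \beta\alpha = \alpha\beta^s \rangle$ (that is, $x \mapsto \alpha$, $y \mapsto \beta$ defines an automorphism of $G_{n,s}$) and $$S = \beta^{[n-1]} \boldsymbol{\cdot} (\alpha\beta^t)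 \quad \text{for some integer } 0 \le t \le n-1 .$$ -/

import Mathlib

/-! Sequences over a group are finite unordered lists of terms with repetition, that is, multisets;
concatenation is the sum of multisets, `T` is a subsequence of `S` when `T ≤ S`, and the length is
`Multiset.card`. -/

namespace ZeroSum

section Sequences

variable {G : Type*} [Group G]

/-- The set `π(S)` of all products of the terms of `S`, each term used with its multiplicity, taken
in an arbitrary order. -/
def products (S : Multiset G) : Set G :=
  {g | ∃ l : List G, (l : Multiset G) = S ∧ l.prod = g}

/-- `S` is a product-one sequence: its terms multiply to `1` in some order. -/
def IsProductOne (S : Multiset G) : Prop :=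
  1 ∈ products S

/-- `S` is a short product-one sequence: product-one with `1 ≤ |S| ≤ exp(G)`. -/
def IsShortProductOne (S : Multiset G) : Prop :=
  IsProductOne S ∧ 1 ≤ Multiset.card S ∧ Multiset.card S ≤ Monoid.exponent G

/-- `S` has a short product-one subsequence. -/
def HasShortProductOneSubseq (S : Multiset G) : Prop :=
  ∃ T : Multiset G, T ≤ S ∧ IsShortProductOne T

variable (G) in
/-- The constant `η(G)`: the smallest `ℓ > 0` such that every sequence over `G` of length at least
`ℓ` has a short product-one subsequence. (If there is no such `ℓ`, the value is `0`, so a positive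
value is always an attained minimum.) -/
noncomputable def eta : ℕ :=
  sInf {ℓ : ℕ | 0 < ℓ ∧ ∀ S : Multiset G, ℓ ≤ Multiset.card S → HasShortProductOneSubseq S}

end Sequences

section Group

/-- The relators of the presentation `⟨x, y ∣ x² = yⁿ = 1, y x = x yˢ⟩`, where `x` and `y` are the
free generators with index `0` and `1`. -/
def relators (n : ℕ) (s : ℤ) : Set (FreeGroup (Fin 2)) :=
  {FreeGroup.of 0 ^ 2,
   FreeGroup.of 1 ^ n,
   (FreeGroup.of 1 * FreeGroup.of 0) * (FreeGroup.of 0 * FreeGroup.of 1 ^ s)⁻¹}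

/-- The group `G_{n,s} = C_n ⋊_s C_2 = ⟨x, y ∣ x² = yⁿ = 1, y x = x yˢ⟩`. -/
abbrev Gns (n : ℕ) (s : ℤ) : Type :=
  PresentedGroup (relators n s)

/-- `G ≃ ⟨α, β ∣ α² = βⁿ = 1, β α = α βˢ⟩` for the elements `α`, `β` of `G`: the
presented group on the right is isomorphic to `G` by an isomorphism that sends its two generators
to `α` and `β`. -/
def IsPresentedBy {G : Type*} [Group G] (n : ℕ) (s : ℤ) (α β : G) : Prop :=
  ∃ e : PresentedGroup (relators n s) ≃* G,
    e (PresentedGroup.of 0) = α ∧ e (PresentedGroup.of 1) = β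

end Group

end ZeroSum

/-! Since `y` has order `n`, the exponent is at least `n`. Hence a sequence of length `n` has no
short product-one subsequence exactly when it is product-one free, and the inverse statement becomes
`ProductOneFree.isExtremal`.

The method is to pass to a quotient and cut the sequence into disjoint blocks whose products lie in
the finite kernel `K`. Partial products of a product-one free list are distinct, so there are at
most `|K| - 1` blocks. At this bound the situation is rigid: if `K` is commutative the block
products are all equal (`blocks_prod_eq`), and once `|K| - 2` blocks are fixed the product of one
more is determined (`block_prod_unique`). Exchanging terms between blocks turns this into equality
of terms.

Let `κ = gcd(n, s - 1)` and `q = n / κ`; then `q, κ ≥ 2` and `s ≡ -1` mod `q`. Modulo `⟨y ^ q⟩`, of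
order `κ`, the group is dihedral of order `2q`.

If `q ≥ 3`, any `q + 1` terms contain a block of length at most `q` (`exists_dihedral_block`), so in
a product-one free sequence of length `n` no block is shorter than `q` (`le_length_of_block`). With
two terms outside `⟨y⟩` this forces `q ≤ 4`, at most three such terms, and all other terms equal.
With at most one such term, the remaining `n - 1` terms lie in a cyclic group of order `n` and are
equal.

If `q = 2`, the quotient is the Klein four-group and `s ≡ 1 + n / 2`. Pairing terms of equal image
gives `κ - 1` pairs and two leftover terms. Elements with distinct nontrivial images commute up to
the central involution `y ^ κ`, which forces all pairs to have one image, and then their terms to be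
equal.

In both cases `IsPresentedBy.not_productOneFree` excludes a power of `β` of length at least `n - 3`
together with two terms outside `⟨β⟩`.

For `η`, extremal sequences give the lower bound. In a sequence of length `n + 1` without short
product-one subsequences every subsequence of length `n` would be extremal, which the multiplicities
forbid. -/

namespace ZeroSum

/-! ### Multisets and lists of terms. -/

section Multisets

variable {G : Type*}

theorem coe_le_coe_of_sublist {l l' : List G} (h : l.Sublist l') :
    (l : Multiset G) ≤ (l' : Multiset G) :=
  Multiset.coe_le.2 h.subperm

theorem eq_replicate_of_pairs {S : Multiset G} (h : ∀ a b, ({a, b} : Multiset G) ≤ S → a = b)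
    {a : G} (ha : a ∈ S) : S = Multiset.replicate S.card a := by
  rw [Multiset.eq_replicate]
  refine ⟨rfl, fun b hb => ?_⟩
  obtain ⟨T, rfl⟩ := Multiset.exists_cons_of_mem ha
  rcases Multiset.mem_cons.1 hb with rfl | hb
  · rfl
  · refine (h a b ?_).symm
    exact Multiset.cons_le_cons _ (Multiset.singleton_le.2 hb)

/-- A list below the image of a multiset lifts to a list below the multiset. -/
theorem exists_list_of_le_map {H : Type*} (f : G → H) (l : List H) :
    ∀ S : Multiset G, (l : Multiset H) ≤ S.map f → ∃ t : List G, (t : Multiset G) ≤ S ∧ t.map f = l := by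
  induction l with
  | nil => intro S _; exact ⟨[], by simp, rfl⟩
  | cons a l ih =>
    intro S hS
    have ha : a ∈ S.map f := Multiset.mem_of_le hS (by simp)
    obtain ⟨g, hg, rfl⟩ := Multiset.mem_map.1 ha
    obtain ⟨T, rfl⟩ := Multiset.exists_cons_of_mem hg
    rw [Multiset.map_cons, ← Multiset.cons_coe, Multiset.cons_le_cons_iff] at hS
    obtain ⟨t, ht, rfl⟩ := ih T hS
    exact ⟨g :: t, by rw [← Multiset.cons_coe]; exact Multiset.cons_le_cons _ ht, rfl⟩

end Multisets

/-! ### Product-one free sequences: the bound on blocks and its rigidity. -/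

section Lists

variable {G : Type*} [Group G]

/-- `S` is product-one free: no nonempty subsequence has product `1` in any order. -/
def ProductOneFree (S : Multiset G) : Prop :=
  ∀ l : List G, l ≠ [] → (l : Multiset G) ≤ S → l.prod ≠ 1

theorem ProductOneFree.mono {S T : Multiset G} (h : ProductOneFree S) (hT : T ≤ S) :
    ProductOneFree T :=
  fun l hl hle => h l hl (hle.trans hT)

/-- The partial products of a list without nonempty sublists of product `1` are distinct. -/
theorem take_prod_injective {l : List G} (h : ∀ t : List G, t ≠ [] → t.Sublist l → t.prod ≠ 1) :
    Function.Injective (fun i : Fin (l.length + 1) => (l.take i).prod) := by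
  have key : ∀ i j : ℕ, i < j → j ≤ l.length → (l.take i).prod ≠ (l.take j).prod := by
    intro i j hij hj he
    have h1 : l.take j = l.take i ++ (l.drop i).take (j - i) := by
      rw [← List.take_add]; congr 1; omega
    rw [h1, List.prod_append] at he
    refine h ((l.drop i).take (j - i)) ?_ ?_ (by simpa using he.symm)
    · intro h0
      have := congrArg List.length h0
      simp at this
      omega
    · exact (List.take_sublist _ _).trans (List.drop_sublist _ _)
  intro i j hij
  rcases lt_trichotomy (i : ℕ) j with hlt | heq | hlt
  · exact absurd hij (key i j hlt (by omega))
  · exact Fin.ext heq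
  · exact absurd hij.symm (key j i hlt (by omega))

open Classical in
/-- The set of partial products of a list. -/
noncomputable def partialProducts (l : List G) : Finset G :=
  Finset.image (fun i : Fin (l.length + 1) => (l.take i).prod) Finset.univ

theorem mem_partialProducts {l : List G} {g : G} :
    g ∈ partialProducts l ↔ ∃ i ≤ l.length, (l.take i).prod = g := by
  simp only [partialProducts, Finset.mem_image, Finset.mem_univ, true_and]
  constructor
  · rintro ⟨i, hi⟩; exact ⟨i, by omega, hi⟩
  · rintro ⟨i, hi, h⟩; exact ⟨⟨i, by omega⟩, h⟩

theorem card_partialProducts {l : List G}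
    (h : ∀ t : List G, t ≠ [] → t.Sublist l → t.prod ≠ 1) :
    (partialProducts l).card = l.length + 1 := by
  classical
  rw [partialProducts, Finset.card_image_of_injective _ (take_prod_injective h)]
  simp

theorem partialProducts_subset {l : List G} (K : Subgroup G) (hl : ∀ g ∈ l, g ∈ K) :
    (partialProducts l : Set G) ⊆ K := by
  intro g hg
  obtain ⟨i, -, rfl⟩ := mem_partialProducts.1 hg
  exact K.list_prod_mem fun x hx => hl x (List.mem_of_mem_take hx)

theorem card_le_of_subset {K : Subgroup G} [Finite K] {s : Finset G} (h : (s : Set G) ⊆ K) :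
    s.card ≤ Nat.card K := by
  rw [← Set.ncard_coe_finset]
  exact Set.ncard_le_ncard h (Set.toFinite _)

theorem length_lt_card {l : List G} (K : Subgroup G) [Finite K] (hl : ∀ g ∈ l, g ∈ K)
    (h : ∀ t : List G, t ≠ [] → t.Sublist l → t.prod ≠ 1) : l.length + 1 ≤ Nat.card K := by
  rw [← card_partialProducts h]
  exact card_le_of_subset (partialProducts_subset K hl)

/-- The partial products of `l` miss at most one element of `K`, and both `z⁻¹` and `z'⁻¹` must be
missed. -/
theorem head_unique {l : List G} {z z' : G} (K : Subgroup G) [Finite K]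
    (hl : ∀ g ∈ l, g ∈ K) (hz : z ∈ K) (hz' : z' ∈ K) (hK : Nat.card K ≤ l.length + 2)
    (h : ∀ t : List G, t ≠ [] → t.Sublist (z :: l) → t.prod ≠ 1)
    (h' : ∀ t : List G, t ≠ [] → t.Sublist (z' :: l) → t.prod ≠ 1) : z = z' := by
  classical
  by_contra hne
  have hP : ∀ w, (∀ t : List G, t ≠ [] → t.Sublist (w :: l) → t.prod ≠ 1) →
      w⁻¹ ∉ partialProducts l := by
    intro w hw hmem
    obtain ⟨i, -, hi⟩ := mem_partialProducts.1 hmem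
    refine hw (w :: l.take i) (by simp) ((List.take_sublist _ _).cons_cons _) ?_
    simp [hi]
  have hc : (insert z⁻¹ (insert z'⁻¹ (partialProducts l))).card = l.length + 1 + 1 + 1 := by
    rw [Finset.card_insert_of_notMem, Finset.card_insert_of_notMem (hP z' h'),
      card_partialProducts fun t ht hs => h t ht (hs.trans (List.sublist_cons_self _ _))]
    simp only [Finset.mem_insert, inv_inj, not_or]
    exact ⟨hne, hP z h⟩
  have := card_le_of_subset (K := K) (s := insert z⁻¹ (insert z'⁻¹ (partialProducts l))) (by
    intro g hg
    simp only [Finset.coe_insert, Set.mem_insert_iff] at hg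
    rcases hg with rfl | rfl | hg
    · exact K.inv_mem hz
    · exact K.inv_mem hz'
    · exact partialProducts_subset K hl hg)
  omega

/-- The partial products exhaust `K`, so `b` is one of them. It is not the empty one, and if it were
`a * b * ⋯`, cancelling `b` would leave a sublist starting with `a` of product `1`; so it is `a`. -/
theorem first_two_eq {l : List G} {a b : G} (K : Subgroup G) [Finite K]
    (hl : ∀ g ∈ a :: b :: l, g ∈ K) (hK : Nat.card K ≤ l.length + 3) (hab : a * b = b * a)
    (h : ∀ t : List G, t ≠ [] → t.Sublist (a :: b :: l) → t.prod ≠ 1) : a = b := by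
  have hsub := partialProducts_subset K hl
  have hb : b ∈ partialProducts (a :: b :: l) := by
    by_contra hb
    have := card_le_of_subset (K := K) (s := Finset.cons b _ hb) (by
      intro g hg
      simp only [Finset.coe_cons, Set.mem_insert_iff] at hg
      rcases hg with rfl | hg
      · exact hl _ (by simp)
      · exact hsub hg)
    rw [Finset.card_cons, card_partialProducts h] at this
    simp at this
    omega
  obtain ⟨i, hi, hbi⟩ := mem_partialProducts.1 hb
  match i, hbi with
  | 0, hbi => exact absurd hbi.symm (by simpa using h [b] (by simp) (by simp))
  | 1, hbi => simpa using hbi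
  | i + 2, hbi =>
    exfalso
    simp only [List.take_succ_cons, List.prod_cons] at hbi
    refine h (a :: l.take i) (by simp)
      (((List.take_sublist _ _).trans (List.sublist_cons_self _ _)).cons_cons _) ?_
    rw [← mul_assoc, hab, mul_assoc] at hbi
    simpa using hbi

/-- Transfers product-one freeness from terms to block products, so that the counting lemmas apply
to the latter inside `K`. -/
theorem ProductOneFree.sublist_map_prod {S : Multiset G} (hS : ProductOneFree S)
    {bs : List (List G)} (hle : (bs.flatten : Multiset G) ≤ S) (hne : ∀ b ∈ bs, b ≠ [])
    (t : List G) (ht : t ≠ []) (hsub : t.Sublist (bs.map List.prod)) : t.prod ≠ 1 := by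
  obtain ⟨cs, hcs, rfl⟩ := List.sublist_map_iff.1 hsub
  rw [← List.prod_flatten]
  refine hS _ ?_ ((coe_le_coe_of_sublist hcs.flatten).trans hle)
  intro h0
  rw [List.flatten_eq_nil_iff] at h0
  cases cs with
  | nil => simp at ht
  | cons c cs => exact hne c (hcs.subset (by simp)) (h0 c (by simp))

/-- A product-one free sequence has fewer than `|K|` disjoint subsequences with products in `K`. -/
theorem ProductOneFree.length_blocks_lt {S : Multiset G} (hS : ProductOneFree S)
    (K : Subgroup G) [Finite K] {bs : List (List G)} (hle : (bs.flatten : Multiset G) ≤ S)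
    (hne : ∀ b ∈ bs, b ≠ []) (hK : ∀ b ∈ bs, b.prod ∈ K) : bs.length + 1 ≤ Nat.card K := by
  have := length_lt_card (l := bs.map List.prod) K (by simpa using hK)
    (hS.sublist_map_prod hle hne)
  simpa using this

theorem ProductOneFree.block_prod_unique {S : Multiset G} (hS : ProductOneFree S)
    (K : Subgroup G) [Finite K] {bs : List (List G)} {b b' : List G}
    (hle : ((b ++ bs.flatten : List G) : Multiset G) ≤ S)
    (hle' : ((b' ++ bs.flatten : List G) : Multiset G) ≤ S)
    (hb0 : b ≠ []) (hb0' : b' ≠ []) (hne : ∀ c ∈ bs, c ≠ [])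
    (hb : b.prod ∈ K) (hb' : b'.prod ∈ K) (hK : ∀ c ∈ bs, c.prod ∈ K)
    (hcard : Nat.card K ≤ bs.length + 2) : b.prod = b'.prod := by
  refine head_unique (l := bs.map List.prod) K (by simpa using hK) hb hb' (by simpa using hcard)
    ?_ ?_
  · exact hS.sublist_map_prod (bs := b :: bs) (by simpa using hle) (by simpa [hb0] using hne)
  · exact hS.sublist_map_prod (bs := b' :: bs) (by simpa using hle') (by simpa [hb0'] using hne)

theorem ProductOneFree.blocks_prod_eq {S : Multiset G} (hS : ProductOneFree S)
    (K : Subgroup G) [Finite K] (hcomm : ∀ a ∈ K, ∀ b ∈ K, a * b = b * a)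
    {bs : List (List G)} {b b' : List G}
    (hle : ((b :: b' :: bs).flatten : Multiset G) ≤ S)
    (hne : ∀ c ∈ b :: b' :: bs, c ≠ []) (hK : ∀ c ∈ b :: b' :: bs, c.prod ∈ K)
    (hcard : Nat.card K ≤ bs.length + 3) : b.prod = b'.prod := by
  refine first_two_eq (l := bs.map List.prod) K (by simpa using hK) (by simpa using hcard)
    (hcomm _ (hK _ (by simp)) _ (hK _ (by simp))) ?_
  exact hS.sublist_map_prod (bs := b :: b' :: bs) hle hne

/-- The terms of a product-one free sequence of length `|K| - 1` over `K` are all equal. -/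
theorem ProductOneFree.eq_of_pair_le {S : Multiset G} (hS : ProductOneFree S)
    (K : Subgroup G) [Finite K] (hcomm : ∀ a ∈ K, ∀ b ∈ K, a * b = b * a)
    (hK : ∀ g ∈ S, g ∈ K) (hcard : Nat.card K ≤ S.card + 1) {a b : G}
    (hab : ({a, b} : Multiset G) ≤ S) : a = b := by
  obtain ⟨T, rfl⟩ := Multiset.le_iff_exists_add.1 hab
  have hT : T = (T.toList : Multiset G) := by simp
  refine first_two_eq (l := T.toList) K ?_ ?_ (hcomm _ (hK _ (by simp)) _ (hK _ (by simp))) ?_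
  · intro g hg; apply hK; simpa [or_assoc] using hg
  · simp at hcard ⊢; omega
  · intro t ht hsub
    refine hS t ht ((coe_le_coe_of_sublist hsub).trans (le_of_eq ?_))
    rw [← Multiset.cons_coe, ← Multiset.cons_coe, ← hT]
    simp

theorem ProductOneFree.card_lt {S : Multiset G} (hS : ProductOneFree S)
    (K : Subgroup G) [Finite K] (hK : ∀ g ∈ S, g ∈ K) : S.card + 1 ≤ Nat.card K := by
  have := length_lt_card (l := S.toList) K (by simpa using hK) (fun t ht hsub =>
    hS t ht ((coe_le_coe_of_sublist hsub).trans (by simp)))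
  simpa using this

theorem ProductOneFree.pow_ne_one {S : Multiset G} (hS : ProductOneFree S) {g : G} {k j : ℕ}
    (hk : Multiset.replicate k g ≤ S) (hj : 0 < j) (hjk : j ≤ k) : g ^ j ≠ 1 := by
  have := hS (List.replicate j g) (by simp; omega)
    (le_trans (by rw [Multiset.coe_replicate]; exact Multiset.replicate_mono g hjk) hk)
  simpa using this

end Lists

/-! ### The group `G_{n,s}`: normal forms, a faithful enough action, and its presentations. -/

section Presentation

theorem zpow_mul_of_relation {G : Type*} [Group G] {α β : G} {s : ℤ} (h : β * α = α * β ^ s)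
    (i : ℤ) : β ^ i * α = α * β ^ (s * i) := by
  have h1 : SemiconjBy α (β ^ s) β := h.symm
  have := (h1.zpow_right i).eq
  rw [← zpow_mul] at this
  exact this.symm

/-- The homomorphism from the presented group given by elements satisfying the relations. -/
def presentedLift {G : Type*} [Group G] {n : ℕ} {s : ℤ} (α β : G) (hα : α ^ 2 = 1)
    (hβ : β ^ n = 1) (h : β * α = α * β ^ s) : Gns n s →* G :=
  PresentedGroup.toGroup (f := ![α, β]) (rels := relators n s) (by
    intro r hr
    rcases hr with rfl | rfl | rfl
    · simpa using hα
    · simpa using hβ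
    · simp [h])

section
variable {G : Type*} [Group G] {n : ℕ} {s : ℤ} (α β : G) (hα : α ^ 2 = 1)
    (hβ : β ^ n = 1) (h : β * α = α * β ^ s)

@[simp] theorem presentedLift_zero :
    presentedLift α β hα hβ h (PresentedGroup.of 0) = α := by
  simp [presentedLift]

@[simp] theorem presentedLift_one :
    presentedLift α β hα hβ h (PresentedGroup.of 1) = β := by
  simp [presentedLift]
end

section Generators

variable (n : ℕ) (s : ℤ)

/-- The generator `x`. -/
def genX : Gns n s := PresentedGroup.of 0

/-- The generator `y`. -/
def genY : Gns n s := PresentedGroup.of 1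

theorem genX_sq : genX n s ^ 2 = 1 :=
  PresentedGroup.one_of_mem (rels := relators n s) (x := FreeGroup.of 0 ^ 2) (by simp [relators])

theorem genY_pow : genY n s ^ n = 1 :=
  PresentedGroup.one_of_mem (rels := relators n s) (x := FreeGroup.of 1 ^ n) (by simp [relators])

theorem genY_mul_genX : genY n s * genX n s = genX n s * genY n s ^ s :=
  mul_inv_eq_one.1 (PresentedGroup.one_of_mem (rels := relators n s)
    (x := (FreeGroup.of 1 * FreeGroup.of 0) * (FreeGroup.of 0 * FreeGroup.of 1 ^ s)⁻¹)
    (by simp [relators]))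

theorem genX_mul_genX : genX n s * genX n s = 1 := by rw [← pow_two, genX_sq]

theorem zpow_genY_mul_genX (i : ℤ) :
    genY n s ^ i * genX n s = genX n s * genY n s ^ (s * i) :=
  zpow_mul_of_relation (genY_mul_genX n s) i

theorem rot_mul_refl (i j : ℤ) :
    genY n s ^ i * (genX n s * genY n s ^ j) = genX n s * genY n s ^ (s * i + j) := by
  rw [← mul_assoc, zpow_genY_mul_genX, mul_assoc, ← zpow_add]

theorem refl_mul_rot (i j : ℤ) :
    (genX n s * genY n s ^ i) * genY n s ^ j = genX n s * genY n s ^ (i + j) := by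
  rw [mul_assoc, ← zpow_add]

theorem refl_mul_refl (i j : ℤ) :
    (genX n s * genY n s ^ i) * (genX n s * genY n s ^ j) = genY n s ^ (s * i + j) := by
  rw [mul_assoc, rot_mul_refl, ← mul_assoc, genX_mul_genX, one_mul]

variable {n s}

theorem genY_zpow_congr {i j : ℤ} (h : i ≡ j [ZMOD n]) : genY n s ^ i = genY n s ^ j := by
  obtain ⟨k, hk⟩ := h.dvd
  have : j = i + n * k := by linarith
  rw [this, zpow_add, zpow_mul, zpow_natCast, genY_pow, one_zpow, mul_one]

theorem eq_rot_or_refl (g : Gns n s) :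
    ∃ i : ℤ, g = genY n s ^ i ∨ g = genX n s * genY n s ^ i := by
  have hg : g ∈ Subgroup.closure (Set.range (PresentedGroup.of : Fin 2 → Gns n s)) := by
    rw [PresentedGroup.closure_range_of]; trivial
  induction hg using Subgroup.closure_induction with
  | mem g hg =>
    obtain ⟨k, rfl⟩ := hg
    fin_cases k
    · exact ⟨0, Or.inr (by simp [genX])⟩
    · exact ⟨1, Or.inl (by simp [genY])⟩
  | one => exact ⟨0, Or.inl (by simp)⟩
  | mul a b _ _ ha hb =>
    obtain ⟨i, rfl | rfl⟩ := ha <;> obtain ⟨j, rfl | rfl⟩ := hb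
    · exact ⟨i + j, Or.inl (zpow_add _ _ _).symm⟩
    · exact ⟨_, Or.inr (rot_mul_refl n s i j)⟩
    · exact ⟨_, Or.inr (refl_mul_rot n s i j)⟩
    · exact ⟨_, Or.inl (refl_mul_refl n s i j)⟩
  | inv a _ ha =>
    obtain ⟨i, rfl | rfl⟩ := ha
    · exact ⟨-i, Or.inl (zpow_neg _ _).symm⟩
    · refine ⟨-(s * i), Or.inr (inv_eq_of_mul_eq_one_right ?_)⟩
      rw [refl_mul_refl, add_neg_cancel, zpow_zero]

theorem finite_Gns (hn : 0 < n) : Finite (Gns n s) := by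
  have hfin : Finite (Subgroup.zpowers (genY n s)) :=
    isOfFinOrder_iff_pow_eq_one.2 ⟨n, hn, genY_pow n s⟩ |>.finite_zpowers
  refine Finite.of_surjective
    (fun p : Bool × Subgroup.zpowers (genY n s) => bif p.1 then (p.2 : Gns n s) else genX n s * p.2)
    fun g => ?_
  obtain ⟨i, rfl | rfl⟩ := eq_rot_or_refl g
  · exact ⟨(true, ⟨_, Subgroup.zpow_mem_zpowers _ i⟩), rfl⟩
  · exact ⟨(false, ⟨_, Subgroup.zpow_mem_zpowers _ i⟩), rfl⟩

end Generators

section Representation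

variable {n : ℕ} {s : ℤ}

/-- The action of `G_{n,s}` on `ℤ/n` by affine maps. -/
noncomputable def affineRep (hs : s ^ 2 ≡ 1 [ZMOD n]) : Gns n s →* Equiv.Perm (ZMod n) :=
  have hs' : (s : ZMod n) * s = 1 := by
    have := (ZMod.intCast_eq_intCast_iff _ _ n).2 hs
    push_cast at this
    rw [← this, sq]
  presentedLift
    ⟨fun z : ZMod n => s * z, fun z : ZMod n => s * z,
      fun z => by simp [← mul_assoc, hs'], fun z => by simp [← mul_assoc, hs']⟩
    (Equiv.addRight (1 : ZMod n))
    (by ext z; simp [sq, ← mul_assoc, hs'])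
    (by ext z; simp)
    (by ext z; simp [mul_add, hs'])

theorem affineRep_genY (hs : s ^ 2 ≡ 1 [ZMOD n]) (i : ℤ) (z : ZMod n) :
    affineRep hs (genY n s ^ i) z = z + i := by
  simp [affineRep, genY]

theorem affineRep_genX (hs : s ^ 2 ≡ 1 [ZMOD n]) (z : ZMod n) :
    affineRep hs (genX n s) z = s * z := by
  simp [affineRep, genX]

theorem genY_zpow_eq_one (hs : s ^ 2 ≡ 1 [ZMOD n]) {i : ℤ} :
    genY n s ^ i = 1 ↔ (n : ℤ) ∣ i := by
  constructor
  · intro h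
    have := affineRep_genY hs i 0
    rw [h] at this
    rw [← ZMod.intCast_zmod_eq_zero_iff_dvd]
    simpa using this.symm
  · rintro ⟨k, rfl⟩
    rw [zpow_mul, zpow_natCast, genY_pow, one_zpow]

theorem orderOf_genY (hs : s ^ 2 ≡ 1 [ZMOD n]) : orderOf (genY n s) = n := by
  refine Nat.dvd_antisymm (orderOf_dvd_of_pow_eq_one (genY_pow n s)) ?_
  have : genY n s ^ ((orderOf (genY n s) : ℕ) : ℤ) = 1 := by
    rw [zpow_natCast, pow_orderOf_eq_one]
  exact_mod_cast (genY_zpow_eq_one hs).1 this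

/-- In the affine action `x` fixes `0` while `y ^ i` translates by `i`. Equality would make `x` act
trivially, that is, `s ≡ 1`. -/
theorem genX_notMem (hs : s ^ 2 ≡ 1 [ZMOD n]) (hs1 : ¬ s ≡ 1 [ZMOD n]) :
    genX n s ∉ Subgroup.zpowers (genY n s) := by
  rintro ⟨i, hi⟩
  have hi : genY n s ^ i = genX n s := hi
  have h0 := affineRep_genX hs 0
  have h1 := affineRep_genX hs 1
  rw [← hi, affineRep_genY] at h0 h1
  apply hs1
  rw [← ZMod.intCast_eq_intCast_iff]
  simp only [zero_add, mul_zero] at h0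
  simp [h0] at h1
  simp [← h1]

theorem refl_notMem (hs : s ^ 2 ≡ 1 [ZMOD n]) (hs1 : ¬ s ≡ 1 [ZMOD n]) (i : ℤ) :
    genX n s * genY n s ^ i ∉ Subgroup.zpowers (genY n s) := fun h =>
  genX_notMem hs hs1 ((Subgroup.mul_mem_cancel_right _ (Subgroup.zpow_mem_zpowers _ _)).1 h)

end Representation

section PresentedBy

variable {n : ℕ} {s : ℤ}

/-- The induced endomorphism is injective on the normal forms `y ^ i` and `x * y ^ i`, and the group
is finite. -/
theorem isPresentedBy_of_relations (hn : 0 < n) {α β : Gns n s}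
    (hα : α ^ 2 = 1) (h : β * α = α * β ^ s) (hβ : orderOf β = n)
    (hαβ : α ∉ Subgroup.zpowers β) : IsPresentedBy n s α β := by
  have hβn : β ^ n = 1 := orderOf_dvd_iff_pow_eq_one.1 hβ.dvd
  let f := presentedLift (n := n) (s := s) α β hα hβn h
  have hfX : f (genX n s) = α := presentedLift_zero ..
  have hfY : f (genY n s) = β := presentedLift_one ..
  have hinj : Function.Injective f := by
    rw [injective_iff_map_eq_one]
    intro g hg
    obtain ⟨i, rfl | rfl⟩ := eq_rot_or_refl g
    · rw [map_zpow, hfY, ← orderOf_dvd_iff_zpow_eq_one, hβ] at hg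
      obtain ⟨k, rfl⟩ := hg
      rw [zpow_mul, zpow_natCast, genY_pow, one_zpow]
    · rw [map_mul, map_zpow, hfX, hfY] at hg
      exact absurd ⟨-i, by simpa using (eq_inv_of_mul_eq_one_left hg).symm⟩ hαβ
  have := finite_Gns (s := s) hn
  refine ⟨MulEquiv.ofBijective f (Finite.injective_iff_bijective.1 hinj), hfX, hfY⟩

theorem isPresentedBy_gen : IsPresentedBy n s (genX n s) (genY n s) :=
  ⟨MulEquiv.refl _, rfl, rfl⟩

section
variable {α β : Gns n s} (h : IsPresentedBy n s α β)
include h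

theorem IsPresentedBy.pow_eq_one : β ^ n = 1 := by
  obtain ⟨e, rfl, rfl⟩ := h
  rw [← map_pow]
  exact (congrArg e (genY_pow n s)).trans (map_one e)

theorem IsPresentedBy.orderOf_eq (hs : s ^ 2 ≡ 1 [ZMOD n]) : orderOf β = n := by
  obtain ⟨e, rfl, rfl⟩ := h
  exact (MulEquiv.orderOf_eq e (genY n s)).trans (orderOf_genY hs)

theorem IsPresentedBy.relation : β * α = α * β ^ s := by
  obtain ⟨e, rfl, rfl⟩ := h
  simpa [genX, genY] using congrArg e (genY_mul_genX n s)

theorem IsPresentedBy.mul_self : α * α = 1 := by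
  obtain ⟨e, rfl, rfl⟩ := h
  simpa [genX, genY] using congrArg e (genX_mul_genX n s)

theorem IsPresentedBy.exists_of_notMem {g : Gns n s} (hg : g ∉ Subgroup.zpowers β) :
    ∃ i : ℤ, g = α * β ^ i := by
  obtain ⟨e, rfl, rfl⟩ := h
  obtain ⟨i, hi | hi⟩ := eq_rot_or_refl (e.symm g)
  · rw [MulEquiv.symm_apply_eq, map_zpow] at hi
    exact absurd ⟨i, hi.symm⟩ hg
  · rw [MulEquiv.symm_apply_eq, map_mul, map_zpow] at hi
    exact ⟨i, hi⟩

theorem IsPresentedBy.mul_zpow_notMem (hs : s ^ 2 ≡ 1 [ZMOD n]) (hs1 : ¬ s ≡ 1 [ZMOD n])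
    (i : ℤ) : α * β ^ i ∉ Subgroup.zpowers β := by
  obtain ⟨e, rfl, rfl⟩ := h
  rintro ⟨j, hj⟩
  refine refl_notMem hs hs1 i ⟨j, e.injective ?_⟩
  simpa [genX, genY] using hj

end

/-- Residues `0` and `2` would make `n` divide `1` or `3`. -/
theorem three_le_emod (hn : 8 ≤ n) (hs : s ^ 2 ≡ 1 [ZMOD n]) (hs1 : ¬ s ≡ 1 [ZMOD n]) :
    3 ≤ s % n := by
  have hmod : s % n ≡ s [ZMOD n] := Int.mod_modEq s n
  have hsq : (s % n) ^ 2 ≡ 1 [ZMOD n] := (hmod.pow 2).trans hs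
  have h0 : 0 ≤ s % n := Int.emod_nonneg _ (by omega)
  have h1 : s % n ≠ 1 := fun h => hs1 (by rw [h] at hmod; exact hmod.symm)
  by_contra hlt
  have h02 : s % n = 0 ∨ s % n = 2 := by omega
  have hd := hsq.symm.dvd
  rcases h02 with h | h <;> rw [h] at hd
  · have := Int.le_of_dvd (by norm_num) ((Int.dvd_neg).2 hd); norm_num at this; omega
  · have := Int.le_of_dvd (by norm_num) hd; norm_num at this; omega

/-- A sequence with at least `n - 3` copies of `β` and two terms outside `⟨β⟩` is not
product-one free. -/
theorem IsPresentedBy.not_productOneFree {α β γ δ : Gns n s} (h : IsPresentedBy n s α β)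
    (hn : 8 ≤ n) (hs : s ^ 2 ≡ 1 [ZMOD n]) (hs1 : ¬ s ≡ 1 [ZMOD n]) (hs2 : ¬ s ≡ -1 [ZMOD n])
    (hγ : γ ∉ Subgroup.zpowers β) (hδ : δ ∉ Subgroup.zpowers β) {k : ℕ} (hk : n ≤ k + 3) :
    ¬ ProductOneFree (Multiset.replicate k β + {γ, δ}) := by
  intro hS
  obtain ⟨i, rfl⟩ := h.exists_of_notMem hγ
  obtain ⟨j, rfl⟩ := h.exists_of_notMem hδ
  have hmul : ∀ i j : ℤ, α * β ^ i * (α * β ^ j) = β ^ (s * i + j) := fun i j => by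
    rw [mul_assoc, ← mul_assoc (β ^ i), zpow_mul_of_relation h.relation, mul_assoc, ← zpow_add,
      ← mul_assoc, h.mul_self, one_mul]
  have hone : ∀ i : ℤ, (n : ℤ) ∣ i → β ^ i = 1 := fun i hi => by
    obtain ⟨m, rfl⟩ := hi
    rw [zpow_mul, zpow_natCast, h.pow_eq_one, one_zpow]
  have hle : ∀ u v : ℕ, u + v ≤ k →
      ((α * β ^ i :: (List.replicate v β ++ (α * β ^ j) :: List.replicate u β) : List _) :
        Multiset (Gns n s)) ≤ Multiset.replicate k β + {α * β ^ i, α * β ^ j} := by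
    intro u v huv
    have : ((α * β ^ i :: (List.replicate v β ++ (α * β ^ j) :: List.replicate u β) : List _) :
        Multiset (Gns n s)) = Multiset.replicate (u + v) β + {α * β ^ i, α * β ^ j} := by
      rw [← Multiset.cons_coe, ← Multiset.coe_add, ← Multiset.cons_coe, Multiset.coe_replicate,
        Multiset.coe_replicate, add_comm u v, Multiset.replicate_add, Multiset.insert_eq_cons,
        ← Multiset.singleton_add, ← Multiset.singleton_add, ← Multiset.singleton_add]
      abel
    rw [this]
    gcongr
  -- Copies of `β` placed between the two outer terms contribute `s` to the exponent, copies placed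
  -- after them contribute `1`.
  have hprod : ∀ u v : ℕ,
      (α * β ^ i :: (List.replicate v β ++ (α * β ^ j) :: List.replicate u β)).prod
        = β ^ (s * i + j + u + s * v) := by
    intro u v
    rw [List.prod_cons, List.prod_append, List.prod_cons, List.prod_replicate,
      List.prod_replicate, ← zpow_natCast, ← zpow_natCast, ← mul_assoc, ← mul_assoc,
      mul_assoc α, ← zpow_add, hmul, ← zpow_add]
    congr 1; ring
  have hfree : ∀ u v : ℕ, u + v ≤ k → ¬ (n : ℤ) ∣ s * i + j + u + s * v := fun u v huv hd =>
    hS _ (by simp) (hle u v huv) (by rw [hprod, hone _ hd])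
  have h3 := three_le_emod hn hs hs1
  have hlt : s % n < n - 1 := by
    have := Int.emod_lt_of_pos s (show (0 : ℤ) < n by omega)
    by_contra hge
    have he : s % n = n - 1 := by omega
    refine hs2 ((Int.mod_modEq s n).symm.trans ?_)
    rw [he]
    exact (Int.modEq_iff_dvd).2 ⟨-1, by ring⟩
  obtain ⟨c, hc⟩ : ∃ c : ℕ, (c : ℤ) = (s * i + j) % n :=
    ⟨((s * i + j) % n).toNat, Int.toNat_of_nonneg (Int.emod_nonneg _ (by omega))⟩
  obtain ⟨t, ht⟩ : ∃ t : ℕ, (t : ℤ) = s % n :=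
    ⟨(s % n).toNat, Int.toNat_of_nonneg (Int.emod_nonneg _ (by omega))⟩
  have hcn : (c : ℤ) < n := by rw [hc]; exact Int.emod_lt_of_pos _ (by omega)
  obtain ⟨a, ha⟩ : (n : ℤ) ∣ s * i + j - c := by rw [hc]; exact Int.dvd_self_sub_emod
  obtain ⟨b, hb⟩ : (n : ℤ) ∣ s - t := by rw [ht]; exact Int.dvd_self_sub_emod
  rw [← ht] at h3 hlt
  have hc0 : c ≠ 0 := by
    rintro rfl
    exact hfree 0 0 (by omega) ⟨a, by simpa using ha⟩
  -- Otherwise `n - c` trailing copies of `β` already give product `1`. As `k ≥ n - 3`, only `c = 1`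
  -- and `c = 2` survive.
  have hck : c + k < n := by
    by_contra hge
    exact hfree (n - c) 0 (by omega) ⟨a + 1, by push_cast [show c ≤ n by omega]; linarith⟩
  -- One copy of `β` in the middle raises the exponent by `t`, where `3 ≤ t ≤ n - 2`. The
  -- subtraction is genuine since `c + t ≤ n`, and `n - c - t + 1 ≤ n - 3 ≤ k` copies suffice.
  refine hfree (n - c - t) 1 (by omega) ⟨a + b + 1, ?_⟩
  rw [Nat.sub_sub]
  push_cast [show c + t ≤ n by omega]
  linarith

end PresentedBy

/-! ### The dihedral quotient by `⟨y ^ q⟩` and the choice of `q`. -/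

section Dihedral

variable {n q : ℕ} {s : ℤ}

/-- The homomorphism of `G_{n,s}` onto the dihedral group of order `2q`, where `q` divides
`n` and `s + 1`. -/
def toDihedral (hqn : q ∣ n) (hqs : (q : ℤ) ∣ s + 1) : Gns n s →* DihedralGroup q :=
  presentedLift (DihedralGroup.sr 0) (DihedralGroup.r 1)
    (by rw [sq, DihedralGroup.sr_mul_self])
    (by rw [DihedralGroup.r_one_pow, (ZMod.natCast_eq_zero_iff n q).2 hqn,
      DihedralGroup.r_zero])
    (by
      have : (s : ZMod q) = -1 := by
        rw [eq_neg_iff_add_eq_zero]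
        exact_mod_cast (ZMod.intCast_zmod_eq_zero_iff_dvd (s + 1) q).2 hqs
      rw [DihedralGroup.r_one_zpow, this]
      simp)

theorem toDihedral_rot (hqn : q ∣ n) (hqs : (q : ℤ) ∣ s + 1) (i : ℤ) :
    toDihedral hqn hqs (genY n s ^ i) = DihedralGroup.r (i : ZMod q) := by
  simp [toDihedral, genY]

theorem toDihedral_refl (hqn : q ∣ n) (hqs : (q : ℤ) ∣ s + 1) (i : ℤ) :
    toDihedral hqn hqs (genX n s * genY n s ^ i) = DihedralGroup.sr (i : ZMod q) := by
  simp [toDihedral, genX, genY]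

theorem mem_zpowers_of_toDihedral_eq_one (hqn : q ∣ n) (hqs : (q : ℤ) ∣ s + 1) {g : Gns n s}
    (h : toDihedral hqn hqs g = 1) : g ∈ Subgroup.zpowers (genY n s ^ q) := by
  obtain ⟨i, rfl | rfl⟩ := eq_rot_or_refl g
  · rw [toDihedral_rot, ← DihedralGroup.r_zero, DihedralGroup.r.injEq,
      ZMod.intCast_zmod_eq_zero_iff_dvd] at h
    obtain ⟨k, rfl⟩ := h
    exact ⟨k, by simp [zpow_mul]⟩
  · rw [toDihedral_refl, ← DihedralGroup.r_zero] at h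
    cases h

theorem toDihedral_mem_zpowers_iff (hqn : q ∣ n) (hqs : (q : ℤ) ∣ s + 1) {g : Gns n s} :
    g ∈ Subgroup.zpowers (genY n s) ↔ ∃ i, toDihedral hqn hqs g = DihedralGroup.r i := by
  constructor
  · rintro ⟨i, rfl⟩
    exact ⟨_, toDihedral_rot hqn hqs i⟩
  · rintro ⟨j, hj⟩
    obtain ⟨i, rfl | rfl⟩ := eq_rot_or_refl g
    · exact Subgroup.zpow_mem_zpowers _ _
    · simp [toDihedral_refl] at hj

theorem card_kernel {κ : ℕ} (hn : 0 < n) (hs : s ^ 2 ≡ 1 [ZMOD n]) (h : n = q * κ) :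
    Nat.card (Subgroup.zpowers (genY n s ^ q)) = κ := by
  have hq : 0 < q := Nat.pos_of_ne_zero (by rintro rfl; simp at h; omega)
  have := finite_Gns (s := s) hn
  rw [Nat.card_zpowers, orderOf_pow, orderOf_genY hs, Nat.gcd_eq_right ⟨κ, h⟩]
  exact Nat.div_eq_of_eq_mul_right hq h

end Dihedral

section Arithmetic

variable {n : ℕ} {s : ℤ}

/-- Take `κ = gcd(n, s - 1)`. Then `q = n / κ` is coprime to `t = (s - 1) / κ` and divides `t * (s +
1)`, hence `s + 1`. The values `q = 1` and `κ = 1` are the excluded cases `s ≡ 1` and `s ≡ -1`. -/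
theorem exists_factorization (hn : 0 < n) (hs : s ^ 2 ≡ 1 [ZMOD n])
    (hs1 : ¬ s ≡ 1 [ZMOD n]) (hs2 : ¬ s ≡ -1 [ZMOD n]) :
    ∃ q κ : ℕ, n = q * κ ∧ 2 ≤ q ∧ 2 ≤ κ ∧ (q : ℤ) ∣ s + 1 ∧
      ∃ t : ℤ, s - 1 = κ * t ∧ IsCoprime (q : ℤ) t := by
  have hg : Int.gcd n (s - 1) ≠ 0 := by
    rw [Ne, Int.gcd_eq_zero_iff]; omega
  have hg' : ((Int.gcd n (s - 1) : ℕ) : ℤ) ≠ 0 := by exact_mod_cast hg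
  obtain ⟨q, hq⟩ := Int.gcd_dvd_left (n : ℤ) (s - 1)
  obtain ⟨t, ht⟩ := Int.gcd_dvd_right (n : ℤ) (s - 1)
  have hcop : IsCoprime q t := by
    refine ⟨Int.gcdA n (s - 1), Int.gcdB n (s - 1), ?_⟩
    have := Int.gcd_eq_gcd_ab (n : ℤ) (s - 1)
    apply mul_left_cancel₀ hg'
    linear_combination (-Int.gcdA n (s - 1)) * hq - Int.gcdB n (s - 1) * ht - this
  have hpos : 0 < q := by
    by_contra hle
    have : (0 : ℤ) < Int.gcd n (s - 1) := by positivity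
    nlinarith
  generalize Int.gcd n (s - 1) = κ at hg hg' hq ht
  obtain ⟨q, rfl⟩ : ∃ m : ℕ, q = m := ⟨q.toNat, (Int.toNat_of_nonneg hpos.le).symm⟩
  have hn' : n = q * κ := by rw [mul_comm]; exact_mod_cast hq
  have hdvd : (q : ℤ) ∣ s + 1 := by
    obtain ⟨m, hm⟩ := hs.symm.dvd
    refine hcop.dvd_of_dvd_mul_left ⟨m, mul_left_cancel₀ hg' ?_⟩
    linear_combination (-s - 1) * ht + hm + m * hq
  refine ⟨q, κ, hn', ?_, ?_, hdvd, t, ht, hcop⟩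
  · by_contra hlt
    have : q = 1 := by omega
    subst this
    rw [one_mul] at hn'
    subst hn'
    exact hs1 (Int.modEq_iff_dvd.2 ⟨-t, by linarith⟩)
  · by_contra hlt
    have : κ = 1 := by omega
    subst this
    rw [mul_one] at hn'
    subst hn'
    obtain ⟨m, hm⟩ := hdvd
    exact hs2 (Int.modEq_iff_dvd.2 ⟨-m, by linarith⟩)

end Arithmetic

end Presentation

/-! ### Short product-one subsequences over dihedral groups. -/

section MultisetSplitting

variable {G : Type*}

theorem exists_le_card_eq {S : Multiset G} {k : ℕ} (h : k ≤ S.card) :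
    ∃ T ≤ S, T.card = k := by
  refine ⟨(S.toList.take k : List G), ?_, by simpa using h⟩
  exact (coe_le_coe_of_sublist (List.take_sublist _ _)).trans (by simp)

theorem pair_le_of_mem {S : Multiset G} {a b : G} (ha : a ∈ S) (hb : b ∈ S) (hab : a ≠ b) :
    ({a, b} : Multiset G) ≤ S := by
  obtain ⟨T, rfl⟩ := Multiset.exists_cons_of_mem ha
  exact Multiset.cons_le_cons _ (Multiset.singleton_le.2
    ((Multiset.mem_cons.1 hb).resolve_left hab.symm))

end MultisetSplitting

section DihedralBlocks

variable {q : ℕ}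

theorem mem_zpowers_r_one (i : ZMod q) :
    DihedralGroup.r i ∈ Subgroup.zpowers (DihedralGroup.r (1 : ZMod q)) := by
  obtain ⟨k, rfl⟩ := ZMod.intCast_surjective i
  exact ⟨k, DihedralGroup.r_one_zpow k⟩

theorem card_zpowers_r_one : Nat.card (Subgroup.zpowers (DihedralGroup.r (1 : ZMod q))) = q := by
  rw [Nat.card_zpowers, DihedralGroup.orderOf_r_one]

theorem zpowers_comm {G : Type*} [Group G] (g : G) :
    ∀ a ∈ Subgroup.zpowers g, ∀ b ∈ Subgroup.zpowers g, a * b = b * a := by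
  rintro _ ⟨i, rfl⟩ _ ⟨j, rfl⟩
  exact zpow_mul_comm g i j

/-- A sequence of reflections without repetitions has at most `q` terms. -/
theorem card_reflections_le [NeZero q] {F : Multiset (DihedralGroup q)} (hF : F.Nodup)
    (h : ∀ g ∈ F, ∃ i, g = DihedralGroup.sr i) : F.card ≤ q := by
  classical
  rw [← Multiset.toFinset_card_of_nodup hF]
  have : F.toFinset ⊆ Finset.univ.image (DihedralGroup.sr : ZMod q → _) := by
    intro g hg
    obtain ⟨i, rfl⟩ := h g (Multiset.mem_toFinset.1 hg)
    exact Finset.mem_image_of_mem _ (Finset.mem_univ _)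
  exact (Finset.card_le_card this).trans (Finset.card_image_le.trans (by simp [ZMod.card]))

/-- Pigeonhole among the `q - 1` reflections other than a fixed `a ∈ F`: the rest of `F` and the
translates of `a` by the nontrivial partial products of `R` number `|F| - 1 + |R| = q` together, so
they overlap. -/
theorem exists_rotation_between [NeZero q] {R F : Multiset (DihedralGroup q)}
    (hR : ∀ g ∈ R, ∃ i, g = DihedralGroup.r i) (hF : ∀ g ∈ F, ∃ i, g = DihedralGroup.sr i)
    (hFn : F.Nodup) (hfree : ProductOneFree R) (hcard : R.card + F.card = q + 1)
    (hF0 : F ≠ 0) :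
    ∃ a a', ({a, a'} : Multiset (DihedralGroup q)) ≤ F ∧
      ∃ i ≤ R.card, a' = a * (R.toList.take i).prod := by
  classical
  obtain ⟨a, ha⟩ := Multiset.exists_mem_of_ne_zero hF0
  obtain ⟨i₀, rfl⟩ := hF a ha
  have hP : (partialProducts R.toList).card = R.card + 1 := by
    rw [card_partialProducts fun t ht hs =>
      hfree t ht ((coe_le_coe_of_sublist hs).trans (by simp))]
    simp
  have hPrefl : ∀ p ∈ partialProducts R.toList, ∃ i, p = DihedralGroup.r i := by
    intro p hp
    obtain ⟨k, hk⟩ := partialProducts_subset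
      (Subgroup.zpowers (DihedralGroup.r (1 : ZMod q))) (fun g hg => by
        obtain ⟨i, rfl⟩ := hR g (Multiset.mem_toList.1 hg)
        exact mem_zpowers_r_one i) hp
    exact ⟨k, by rw [← hk]; exact DihedralGroup.r_one_zpow k⟩
  have h1P : (1 : DihedralGroup q) ∈ partialProducts R.toList :=
    mem_partialProducts.2 ⟨0, by simp, by simp⟩
  set A := F.toFinset.erase (DihedralGroup.sr i₀) with hA
  set B := ((partialProducts R.toList).erase 1).image (DihedralGroup.sr i₀ * ·) with hB
  have hAc : A.card + 1 = F.card := by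
    rw [hA, Finset.card_erase_add_one (Multiset.mem_toFinset.2 ha),
      Multiset.toFinset_card_of_nodup hFn]
  have hBc : B.card = R.card := by
    rw [hB, Finset.card_image_of_injective _ (mul_right_injective _),
      Finset.card_erase_of_mem h1P, hP, Nat.add_sub_cancel]
  have hU : A ∪ B ⊆ (Finset.univ.erase i₀).image (DihedralGroup.sr : ZMod q → _) := by
    intro g hg
    have : g ≠ DihedralGroup.sr i₀ ∧ ∃ i, g = DihedralGroup.sr i := by
      rcases Finset.mem_union.1 hg with hg | hg
      · rw [hA, Finset.mem_erase, Multiset.mem_toFinset] at hg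
        exact ⟨hg.1, hF g hg.2⟩
      · obtain ⟨p, hp, rfl⟩ := Finset.mem_image.1 hg
        rw [Finset.mem_erase] at hp
        refine ⟨fun h => hp.1 (mul_eq_left.1 h), ?_⟩
        obtain ⟨i, rfl⟩ := hPrefl p hp.2
        exact ⟨_, DihedralGroup.sr_mul_r _ _⟩
    obtain ⟨hne, i, rfl⟩ := this
    exact Finset.mem_image_of_mem _ (Finset.mem_erase.2 ⟨fun h => hne (by rw [h]), Finset.mem_univ _⟩)
  have hUc : (A ∪ B).card + 1 ≤ q := by
    have h1 := Finset.card_le_card hU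
    have h2 := Finset.card_image_le (s := Finset.univ.erase i₀)
      (f := (DihedralGroup.sr : ZMod q → _))
    have h3 := Finset.card_erase_add_one (Finset.mem_univ i₀)
    rw [Finset.card_univ, ZMod.card] at h3
    omega
  have hI : (A ∩ B).Nonempty := by
    rw [← Finset.card_pos]
    have := Finset.card_union_add_card_inter A B
    omega
  obtain ⟨a', ha'⟩ := hI
  obtain ⟨haA, haB⟩ := Finset.mem_inter.1 ha'
  rw [hA, Finset.mem_erase, Multiset.mem_toFinset] at haA
  obtain ⟨p, hp, hpa⟩ := Finset.mem_image.1 haB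
  obtain ⟨i, hi, rfl⟩ := mem_partialProducts.1 (Finset.mem_of_mem_erase hp)
  exact ⟨_, a', pair_le_of_mem ha haA.2 haA.1.symm, i, by simpa using hi, hpa.symm⟩

/-- For `q ≥ 3`, a sequence of length `q + 1` over the dihedral group of order `2q` has a
nonempty product-one subsequence of length at most `q`. -/
theorem exists_dihedral_block (hq : 3 ≤ q) {S : Multiset (DihedralGroup q)}
    (hS : q + 1 ≤ S.card) :
    ∃ l : List (DihedralGroup q), l ≠ [] ∧ (l : Multiset _) ≤ S ∧ l.length ≤ q ∧ l.prod = 1 := by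
  classical
  have : NeZero q := ⟨by omega⟩
  obtain ⟨T, hTS, hT⟩ := exists_le_card_eq hS
  by_contra hcon
  have hno : ∀ l : List (DihedralGroup q), l ≠ [] → (l : Multiset _) ≤ T → l.length ≤ q →
      l.prod ≠ 1 := fun l h0 hl hlen h1 => hcon ⟨l, h0, hl.trans hTS, hlen, h1⟩
  set R := T.filter (fun g => ∃ i, g = DihedralGroup.r i) with hRdef
  set F := T.filter (fun g => ¬ ∃ i, g = DihedralGroup.r i) with hFdef
  have hRF : R + F = T := Multiset.filter_add_not _ T
  have hRT : R ≤ T := hRF ▸ Multiset.le_add_right _ _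
  have hFT : F ≤ T := hRF ▸ Multiset.le_add_left _ _
  have hR : ∀ g ∈ R, ∃ i, g = DihedralGroup.r i := fun g hg => (Multiset.mem_filter.1 hg).2
  have hF : ∀ g ∈ F, ∃ i, g = DihedralGroup.sr i := by
    intro g hg
    have := (Multiset.mem_filter.1 hg).2
    cases g with
    | r i => exact absurd ⟨i, rfl⟩ this
    | sr i => exact ⟨i, rfl⟩
  have hcard : R.card + F.card = q + 1 := by rw [← Multiset.card_add, hRF, hT]
  have hFn : F.Nodup := by
    rw [Multiset.nodup_iff_le]
    intro a ha
    obtain ⟨i, rfl⟩ := hF a (Multiset.mem_of_le ha (by simp))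
    exact hno [DihedralGroup.sr i, DihedralGroup.sr i] (by simp) (le_trans ha hFT)
      (by simp; omega) (by simp)
  have hFq := card_reflections_le hFn hF
  have hRK : ∀ g ∈ R, g ∈ Subgroup.zpowers (DihedralGroup.r (1 : ZMod q)) := by
    intro g hg
    obtain ⟨i, rfl⟩ := hR g hg
    exact mem_zpowers_r_one i
  have hK := card_zpowers_r_one (q := q)
  have hfree : ∀ R' ≤ R, R'.card ≤ q → ProductOneFree R' := fun R' hle hc l h0 hl =>
    hno l h0 (hl.trans (hle.trans hRT)) (le_trans (by simpa using Multiset.card_le_card hl) hc)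
  have hF0 : F ≠ 0 := by
    intro h0
    obtain ⟨R', hR', hc⟩ := exists_le_card_eq (S := R) (k := q) (by simp [h0] at hcard; omega)
    have := (hfree R' hR' hc.le).card_lt _ fun g hg => hRK g (Multiset.mem_of_le hR' hg)
    omega
  have hF1 := Multiset.card_pos.2 hF0
  have hRfree := hfree R le_rfl (by omega)
  have hRlt := hRfree.card_lt _ hRK
  obtain ⟨a, a', haa, i, hi, ha'⟩ := exists_rotation_between hR hF hFn hRfree hcard hF0
  have hinv : ∀ b ∈ F, b * b = 1 := by
    intro b hb
    obtain ⟨i, rfl⟩ := hF b hb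
    exact DihedralGroup.sr_mul_self i
  have hma : a ∈ F := Multiset.mem_of_le haa (by simp)
  have hma' : a' ∈ F := Multiset.mem_of_le haa (by simp)
  have hlist : ∀ (b b' : DihedralGroup q) (l : List (DihedralGroup q)),
      ({b, b'} : Multiset _) ≤ F → (l : Multiset _) ≤ R →
      b * l.prod * b' = 1 → q < l.length + 2 := by
    intro b b' l hb hl h1
    by_contra hlt
    refine hno (b :: (l ++ [b'])) (by simp) ?_ (by simp; omega) (by simpa [mul_assoc] using h1)
    have : ((b :: (l ++ [b']) : List _) : Multiset (DihedralGroup q)) = l + {b, b'} := by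
      rw [← Multiset.cons_coe, ← Multiset.coe_add, Multiset.coe_singleton,
        Multiset.insert_eq_cons, ← Multiset.singleton_add, ← Multiset.singleton_add]
      abel
    rw [this, ← hRF]
    exact add_le_add hl hb
  -- The list `a`, then `i` rotations, then `a'` has product `a' * a' = 1`, so it must be longer
  -- than `q`. This leaves only `|R| = q - 1`, `|F| = 2` and `i = |R|`.
  have hlen : q < i + 2 := by
    have := hlist a a' (R.toList.take i) haa
      ((coe_le_coe_of_sublist (List.take_sublist _ _)).trans (by simp))
      (by rw [← ha', hinv a' hma'])
    simp at this; omega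
  have hF2 : 2 ≤ F.card := by simpa using Multiset.card_le_card haa
  have hi' : i = R.card := by omega
  have hRq : R.card + 1 = q := by omega
  obtain ⟨g, hg⟩ := Multiset.card_pos_iff_exists_mem.1 (show 0 < R.card by omega)
  have hRg : R = Multiset.replicate R.card g := eq_replicate_of_pairs (fun u v huv =>
    hRfree.eq_of_pair_le _ (zpowers_comm _) hRK (by omega) huv) hg
  have hprod : (R.toList.take i).prod = g ^ R.card := by
    have hmem : ∀ x ∈ R.toList, x = g := fun x hx => by
      rw [Multiset.mem_toList, hRg] at hx
      exact Multiset.eq_of_mem_replicate hx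
    rw [hi', List.take_of_length_le (by simp), List.eq_replicate_of_mem hmem, List.prod_replicate,
      Multiset.length_toList]
  have hgq : g ^ R.card * g = 1 := by
    obtain ⟨k, rfl⟩ := hR g hg
    rw [← pow_succ, hRq]
    simp
  -- Now `a' = a * g ^ (q - 1) = a * g⁻¹`, so `a' * g * a = 1` uses only three terms; this is where
  -- `q ≥ 3` enters.
  have := hlist a' a [g] (by rwa [Multiset.pair_comm]) (by simpa using hg) (by
    rw [ha', hprod, List.prod_singleton, mul_assoc a, hgq, mul_one, hinv a hma])
  simp at this
  omega

end DihedralBlocks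

/-! ### Blocks of `G_{n,s}` with product in the kernel. -/

section Blocks

variable {n q : ℕ} {s : ℤ} (hqn : q ∣ n) (hqs : (q : ℤ) ∣ s + 1)

theorem exists_block (hq : 3 ≤ q) {S : Multiset (Gns n s)} (hS : q + 1 ≤ S.card) :
    ∃ l : List (Gns n s), l ≠ [] ∧ (l : Multiset _) ≤ S ∧ l.length ≤ q ∧
      toDihedral hqn hqs l.prod = 1 := by
  obtain ⟨l', h0, hle, hlen, h1⟩ := exists_dihedral_block hq
    (S := S.map (toDihedral hqn hqs)) (by simpa using hS)
  obtain ⟨l, hl, rfl⟩ := exists_list_of_le_map _ l' S hle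
  exact ⟨l, by simpa using h0, hl, by simpa using hlen, by rw [map_list_prod, h1]⟩

/-- Greedy extraction: each block uses at most `q` terms, and the surplus term keeps at least `q +
1` available for the last block. -/
theorem exists_blocks (hq : 3 ≤ q) (k : ℕ) : ∀ {S : Multiset (Gns n s)}, q * k + 1 ≤ S.card →
    ∃ bs : List (List (Gns n s)), bs.length = k ∧ (bs.flatten : Multiset _) ≤ S ∧
      (∀ b ∈ bs, b ≠ []) ∧ ∀ b ∈ bs, toDihedral hqn hqs b.prod = 1 := by
  classical
  induction k with
  | zero => intro S _; exact ⟨[], by simp⟩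
  | succ k ih =>
    intro S hS
    rw [Nat.mul_succ] at hS
    obtain ⟨l, h0, hle, hlen, h1⟩ := exists_block hqn hqs hq (S := S) (by
      have := Nat.zero_le (q * k); omega)
    obtain ⟨bs, hbs, hble, hne, hb1⟩ := ih (S := S - l) (by
      rw [Multiset.card_sub hle, Multiset.coe_card]; omega)
    refine ⟨l :: bs, by simp [hbs], ?_, by simpa [h0] using hne, by simpa [h1] using hb1⟩
    rw [List.flatten_cons, ← Multiset.coe_add]
    exact (add_le_add_right hble _).trans (by rw [add_tsub_cancel_of_le hle])

/-- If `n = q κ`, a product-one free sequence of length `n` has no subsequence of length less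
than `q` with product in the kernel. -/
theorem ProductOneFree.le_length_of_block {κ : ℕ} (hn : 0 < n) (hs : s ^ 2 ≡ 1 [ZMOD n])
    (h : n = q * κ) (hq : 3 ≤ q) {S : Multiset (Gns n s)} (hS : ProductOneFree S)
    (hcard : S.card = n) {l : List (Gns n s)} (h0 : l ≠ []) (hle : (l : Multiset _) ≤ S)
    (h1 : toDihedral hqn hqs l.prod = 1) : q ≤ l.length := by
  classical
  by_contra hlt
  obtain ⟨k, rfl⟩ : ∃ k, κ = k + 1 := Nat.exists_eq_succ_of_ne_zero (by rintro rfl; omega)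
  rw [Nat.mul_succ] at h
  -- If `|l| < q`, at least `q * (κ - 1) + 1` terms remain, enough for `κ - 1` further blocks.
  -- Together with `l` that is one block too many for a kernel of order `κ`.
  obtain ⟨bs, hbs, hble, hne, hb1⟩ := exists_blocks hqn hqs hq k (S := S - l) (by
    rw [Multiset.card_sub hle, Multiset.coe_card]; omega)
  have := finite_Gns (s := s) hn
  have hlen := hS.length_blocks_lt (Subgroup.zpowers (genY n s ^ q)) (bs := l :: bs)
    (by
      rw [List.flatten_cons, ← Multiset.coe_add]
      exact (add_le_add_right hble _).trans (by rw [add_tsub_cancel_of_le hle]))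
    (by simpa [h0] using hne)
    (fun b hb => mem_zpowers_of_toDihedral_eq_one hqn hqs (by
      rcases List.mem_cons.1 hb with rfl | hb
      · exact h1
      · exact hb1 b hb))
  rw [card_kernel hn hs (κ := k + 1) (by rw [Nat.mul_succ]; exact h), List.length_cons, hbs] at hlen
  omega

end Blocks

theorem exists_equal_blocks {G H : Type*} [Group G] [Group H] (f : G →* H) {ρ : H} {q : ℕ}
    (hq : 0 < q) (hρ : ρ ^ q = 1) (k : ℕ) : ∀ {W : Multiset G}, q * k ≤ W.card →
    (∀ g ∈ W, f g = ρ) → ∃ bs : List (List G), bs.length = k ∧ (bs.flatten : Multiset G) ≤ W ∧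
      (∀ b ∈ bs, b ≠ []) ∧ ∀ b ∈ bs, f b.prod = 1 := by
  classical
  induction k with
  | zero => intro W _ _; exact ⟨[], by simp⟩
  | succ k ih =>
    intro W hW hf
    rw [Nat.mul_succ] at hW
    obtain ⟨T, hT, hTc⟩ := exists_le_card_eq (S := W) (k := q) (by omega)
    obtain ⟨bs, hbs, hble, hne, hb1⟩ := ih (W := W - T) (by
      rw [Multiset.card_sub hT]; omega) (fun g hg => hf g (Multiset.mem_of_le tsub_le_self hg))
    refine ⟨T.toList :: bs, by simp [hbs], ?_, ?_, ?_⟩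
    · rw [List.flatten_cons, ← Multiset.coe_add, Multiset.coe_toList]
      exact (add_le_add_right hble _).trans (by rw [add_tsub_cancel_of_le hT])
    · simp only [List.mem_cons, forall_eq_or_imp]
      refine ⟨fun h => ?_, hne⟩
      have := congrArg List.length h
      simp at this
      subst this
      simp at hTc
      omega
    · simp only [List.mem_cons, forall_eq_or_imp]
      refine ⟨?_, hb1⟩
      have : T.toList.map f = List.replicate T.toList.length ρ := by
        have := List.eq_replicate_of_mem (l := T.toList.map f) (a := ρ) (by
          intro b hb
          obtain ⟨g, hg, rfl⟩ := List.mem_map.1 hb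
          exact hf g (Multiset.mem_of_le hT (Multiset.mem_toList.1 hg)))
        simpa using this
      rw [map_list_prod, this, List.prod_replicate, Multiset.length_toList, hTc, hρ]

/-! ### Recognizing extremal sequences. -/

section Structure

variable {n : ℕ} {s : ℤ}

/-- The sequence `β^{[n-1]} · (α β^t)` for generators `α`, `β` satisfying the presentation. -/
def IsExtremal (n : ℕ) (s : ℤ) (S : Multiset (Gns n s)) : Prop :=
  ∃ α β : Gns n s, IsPresentedBy n s α β ∧
    ∃ t : ℕ, t ≤ n - 1 ∧ S = Multiset.replicate (n - 1) β + {α * β ^ t}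

/-- The order divides `n` and exceeds `k ≥ n - 3`, whereas a proper divisor is at most `n / 2`. -/
theorem orderOf_eq_of_replicate_le (hn : 8 ≤ n) {S : Multiset (Gns n s)}
    (hS : ProductOneFree S) {g : Gns n s} {k : ℕ} (hk : n ≤ k + 3)
    (hle : Multiset.replicate k g ≤ S) (hg : g ^ n = 1) : orderOf g = n := by
  obtain ⟨e, he⟩ := orderOf_dvd_of_pow_eq_one hg
  have hpos : 0 < orderOf g := Nat.pos_of_ne_zero (by intro h; rw [h] at he; omega)
  have hlt : k < orderOf g := by
    by_contra hle'
    exact hS.pow_ne_one hle hpos (by omega) (pow_orderOf_eq_one g)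
  generalize orderOf g = d at *
  have : e = 1 := by
    have : e ≠ 0 := by rintro rfl; omega
    by_contra h1
    have h2 : d * 2 ≤ d * e := Nat.mul_le_mul_left d (by omega)
    omega
  subst this
  omega

/-- Conjugation by `x` raises every element of `⟨y⟩` to the power `s`, so any generator of `⟨y⟩` can
replace `y`. -/
theorem isPresentedBy_of_mem_zpowers (hn : 0 < n) (hs : s ^ 2 ≡ 1 [ZMOD n])
    (hs1 : ¬ s ≡ 1 [ZMOD n]) {β : Gns n s} (hβ : β ∈ Subgroup.zpowers (genY n s))
    (ho : orderOf β = n) : IsPresentedBy n s (genX n s) β := by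
  refine isPresentedBy_of_relations hn (genX_sq n s) ?_ ho fun h =>
    genX_notMem hs hs1 ((Subgroup.zpowers_le.2 hβ) h)
  obtain ⟨i, rfl⟩ := hβ
  change genY n s ^ i * _ = _ * (genY n s ^ i) ^ s
  rw [zpow_genY_mul_genX, ← zpow_mul, mul_comm]

theorem IsPresentedBy.isExtremal {α β γ : Gns n s} (h : IsPresentedBy n s α β)
    (hn : 0 < n) (hs : s ^ 2 ≡ 1 [ZMOD n])
    (hS : ProductOneFree (Multiset.replicate (n - 1) β + {γ})) :
    IsExtremal n s (Multiset.replicate (n - 1) β + {γ}) := by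
  have hγ : γ ∉ Subgroup.zpowers β := by
    intro hγ
    have := finite_Gns (s := s) hn
    have hlt := hS.card_lt (Subgroup.zpowers β) (by
      intro g hg
      rcases Multiset.mem_add.1 hg with hg | hg
      · rw [Multiset.eq_of_mem_replicate hg]; exact Subgroup.mem_zpowers β
      · rwa [Multiset.mem_singleton.1 hg])
    rw [Nat.card_zpowers, h.orderOf_eq hs] at hlt
    simp at hlt
    omega
  obtain ⟨i, rfl⟩ := h.exists_of_notMem hγ
  have hmod := Int.emod_nonneg i (show (n : ℤ) ≠ 0 by omega)
  have hlt := Int.emod_lt_of_pos i (show (0 : ℤ) < n by omega)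
  refine ⟨α, β, h, (i % n).toNat, by omega, ?_⟩
  rw [← zpow_natCast β, Int.toNat_of_nonneg hmod]
  congr 3
  rw [zpow_eq_zpow_iff_modEq, h.orderOf_eq hs]
  exact (Int.mod_modEq i n).symm

theorem zpow_pow_eq_one {g : Gns n s} (hg : g ∈ Subgroup.zpowers (genY n s)) : g ^ n = 1 := by
  obtain ⟨i, rfl⟩ := hg
  change (genY n s ^ i) ^ n = 1
  rw [← zpow_natCast, ← zpow_mul, mul_comm, zpow_mul, zpow_natCast, genY_pow, one_zpow]

open Classical in
theorem isExtremal_of_few_reflections (hn : 8 ≤ n) (hs : s ^ 2 ≡ 1 [ZMOD n])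
    (hs1 : ¬ s ≡ 1 [ZMOD n]) {S : Multiset (Gns n s)} (hS : ProductOneFree S)
    (hcard : S.card = n)
    (hF : (S.filter (· ∉ Subgroup.zpowers (genY n s))).card ≤ 1) : IsExtremal n s S := by
  have hfin := finite_Gns (s := s) (show 0 < n by omega)
  set R := S.filter (· ∈ Subgroup.zpowers (genY n s)) with hR
  set F := S.filter (· ∉ Subgroup.zpowers (genY n s))
  have hRF : R + F = S := Multiset.filter_add_not _ S
  have hc : R.card + F.card = n := by rw [← Multiset.card_add, hRF, hcard]
  have hRS : R ≤ S := hRF ▸ Multiset.le_add_right _ _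
  have hRfree := hS.mono hRS
  have hRK : ∀ g ∈ R, g ∈ Subgroup.zpowers (genY n s) := fun g hg => (Multiset.mem_filter.1 hg).2
  have hK : Nat.card (Subgroup.zpowers (genY n s)) = n := by
    rw [Nat.card_zpowers, orderOf_genY hs]
  have hlt := hRfree.card_lt _ hRK
  have hRc : R.card = n - 1 := by omega
  obtain ⟨γ, hγ⟩ := Multiset.card_eq_one.1 (show F.card = 1 by omega)
  obtain ⟨β, hβ⟩ := Multiset.card_pos_iff_exists_mem.1 (show 0 < R.card by omega)
  have hRβ : R = Multiset.replicate (n - 1) β := by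
    rw [← hRc]
    exact eq_replicate_of_pairs (fun u v huv =>
      hRfree.eq_of_pair_le _ (zpowers_comm _) hRK (by omega) huv) hβ
  have ho := orderOf_eq_of_replicate_le hn hS (k := n - 1) (by omega) (hRβ ▸ hRS)
    (zpow_pow_eq_one (hRK β hβ))
  have hp := isPresentedBy_of_mem_zpowers (by omega) hs hs1 (hRK β hβ) ho
  rw [← hRF, hRβ, hγ] at hS ⊢
  exact hp.isExtremal (by omega) hs hS

end Structure

/-! ### The case `q ≥ 3` with at least two terms outside `⟨y⟩`. -/

section LargeQuotient

variable {n q κ : ℕ} {s : ℤ}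

theorem false_of_many_reflections (hn : 8 ≤ n) (hs : s ^ 2 ≡ 1 [ZMOD n])
    (hs1 : ¬ s ≡ 1 [ZMOD n]) (hs2 : ¬ s ≡ -1 [ZMOD n]) (h : n = q * κ) (hq : 3 ≤ q)
    (hκ : 2 ≤ κ) (hqs : (q : ℤ) ∣ s + 1) {R F : Multiset (Gns n s)}
    (hS : ProductOneFree (R + F)) (hcard : R.card + F.card = n)
    (hR : ∀ g ∈ R, g ∈ Subgroup.zpowers (genY n s))
    (hF : ∀ g ∈ F, g ∉ Subgroup.zpowers (genY n s)) (hF2 : 2 ≤ F.card) : False := by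
  classical
  have : NeZero q := ⟨by omega⟩
  have hfin := finite_Gns (s := s) (show 0 < n by omega)
  have hqn : q ∣ n := ⟨κ, h⟩
  set φ := toDihedral hqn hqs with hφ
  have hRr : ∀ g ∈ R, ∃ i, φ g = DihedralGroup.r i := fun g hg =>
    (toDihedral_mem_zpowers_iff hqn hqs).1 (hR g hg)
  have hFs : ∀ g ∈ F, ∃ i, φ g = DihedralGroup.sr i := by
    intro g hg
    cases hg' : φ g with
    | r i => exact absurd ((toDihedral_mem_zpowers_iff hqn hqs).2 ⟨i, hg'⟩) (hF g hg)
    | sr i => exact ⟨i, rfl⟩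
  have hshort : ∀ l : List (Gns n s), l ≠ [] → (l : Multiset _) ≤ R + F → φ l.prod = 1 →
      q ≤ l.length := fun l h0 hl h1 =>
    hS.le_length_of_block hqn hqs (by omega) hs h hq (by simpa using hcard) h0 hl h1
  have hq2 : 2 * q ≤ n := by rw [h, mul_comm 2]; exact Nat.mul_le_mul_left q hκ
  -- Distinct reflections have distinct images.
  have hFdist : ∀ u v, ({u, v} : Multiset (Gns n s)) ≤ F → φ u ≠ φ v := by
    intro u v huv he
    obtain ⟨i, hi⟩ := hFs v (Multiset.mem_of_le huv (by simp))
    have := hshort [u, v] (by simp) (huv.trans (Multiset.le_add_left _ _)) (by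
      rw [List.prod_cons, List.prod_singleton, map_mul, he, hi, DihedralGroup.sr_mul_self])
    simp at this
    omega
  have hFn : (F.map φ).Nodup := by
    rw [Multiset.nodup_iff_le]
    intro a ha
    obtain ⟨l, hl, hm⟩ := exists_list_of_le_map φ [a, a] F ha
    obtain ⟨u, v, rfl⟩ : ∃ u v, l = [u, v] := List.length_eq_two.1 (by
      have := congrArg List.length hm; simpa using this)
    simp only [List.map_cons, List.map_nil, List.cons.injEq, and_true] at hm
    exact hFdist u v hl (hm.1.trans hm.2.symm)
  have hFq : F.card ≤ q := by
    have := card_reflections_le hFn (by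
      intro g hg
      obtain ⟨u, hu, rfl⟩ := Multiset.mem_map.1 hg
      exact hFs u hu)
    simpa using this
  -- All rotations have the same image.
  have hfreeφ : ∀ U ≤ R, U.card + 1 = q → ProductOneFree (U.map φ) := by
    intro U hU hUc l h0 hl h1
    obtain ⟨t, ht, rfl⟩ := exists_list_of_le_map φ l U hl
    have := hshort t (by simpa using h0) (ht.trans (hU.trans (Multiset.le_add_right _ _)))
      (by rw [map_list_prod, h1])
    have h2 := Multiset.card_le_card ht
    simp at h2
    omega
  have hRφ : ∀ g ∈ R, φ g ∈ Subgroup.zpowers (DihedralGroup.r (1 : ZMod q)) := by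
    intro g hg
    obtain ⟨i, hi⟩ := hRr g hg
    rw [hi]
    exact mem_zpowers_r_one i
  have hRpair : ∀ u v, ({u, v} : Multiset (Gns n s)) ≤ R → φ u = φ v := by
    intro u v huv
    obtain ⟨W, rfl⟩ := Multiset.le_iff_exists_add.1 huv
    -- The pair is completed to `q - 1` rotations. Their images form a product-one free sequence of
    -- maximal length in a cyclic group of order `q`, so they coincide.
    obtain ⟨V, hV, hVc⟩ := exists_le_card_eq (S := W) (k := q - 3) (by simp at hcard; omega)
    refine (hfreeφ ({u, v} + V) (by gcongr) (by simp; omega)).eq_of_pair_le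
      (Subgroup.zpowers (DihedralGroup.r (1 : ZMod q))) (zpowers_comm _) ?_ ?_ ?_
    · intro g hg
      obtain ⟨w, hw, rfl⟩ := Multiset.mem_map.1 hg
      exact hRφ w (Multiset.mem_of_le (by gcongr) hw)
    · rw [card_zpowers_r_one]; simp; omega
    · rw [Multiset.map_add]
      exact Multiset.le_add_right _ _
  obtain ⟨h₀, hh₀⟩ := Multiset.card_pos_iff_exists_mem.1 (show 0 < R.card by omega)
  set ρ := φ h₀ with hρ
  have hRρ : ∀ g ∈ R, φ g = ρ := by
    intro g hg
    by_cases hgh : g = h₀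
    · rw [hgh]
    · exact hRpair g h₀ (pair_le_of_mem hg hh₀ hgh)
  have hρq : ρ ^ q = 1 := by
    obtain ⟨i, hi⟩ := hRr h₀ hh₀
    rw [hρ, hi, DihedralGroup.r_pow]
    simp
  have hρr : ∃ i, ρ = DihedralGroup.r i := hRr h₀ hh₀
  have hρord : ∀ j, 0 < j → j < q → ρ ^ j ≠ 1 := by
    intro j hj hjq h1
    obtain ⟨U, hU, hUc⟩ := exists_le_card_eq (S := R) (k := j) (by omega)
    obtain ⟨bs, hbs, hble, hne, hb1⟩ := exists_equal_blocks φ hj h1 1 (W := U) (by omega)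
      (fun g hg => hRρ g (Multiset.mem_of_le hU hg))
    obtain ⟨b, rfl⟩ := List.length_eq_one_iff.1 hbs
    have hb : (b : Multiset _) ≤ U := by simpa using hble
    have := hshort b (hne b (by simp)) (hb.trans (hU.trans (Multiset.le_add_right _ _)))
      (hb1 b (by simp))
    have h2 := Multiset.card_le_card hb
    simp at h2
    omega
  have hρord' : orderOf ρ = q := by
    refine (orderOf_eq_iff (by omega)).2 ⟨hρq, fun j hj hj0 => hρord j hj0 hj⟩
  have hrot : ∀ i : ZMod q, ∃ t < q, DihedralGroup.r i = ρ ^ t := by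
    intro i
    have hle : Subgroup.zpowers ρ ≤ Subgroup.zpowers (DihedralGroup.r (1 : ZMod q)) :=
      Subgroup.zpowers_le.2 (hRφ h₀ hh₀)
    have heq := Subgroup.eq_of_le_of_card_ge hle (by
      rw [card_zpowers_r_one, Nat.card_zpowers, hρord'])
    have hi := mem_zpowers_r_one i
    rw [← heq, mem_zpowers_iff_mem_range_orderOf, hρord'] at hi
    obtain ⟨t, ht, hti⟩ := Finset.mem_image.1 hi
    exact ⟨t, Finset.mem_range.1 ht, hti.symm⟩
  -- Two reflections and some rotations form a block.
  have hblock : ∀ u v, ({u, v} : Multiset (Gns n s)) ≤ F →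
      ∃ t, φ (u * v) * ρ ^ t = 1 ∧ φ (v * u) = ρ ^ t ∧ t ≤ 2 ∧ q ≤ t + 2 := by
    intro u v huv
    obtain ⟨i, hi⟩ := hFs u (Multiset.mem_of_le huv (by simp))
    obtain ⟨j, hj⟩ := hFs v (Multiset.mem_of_le huv (by simp))
    have hne := hFdist u v huv
    obtain ⟨t, htq, ht⟩ := hrot (i - j)
    have ht0 : t ≠ 0 := by
      rintro rfl
      apply hne
      rw [pow_zero, DihedralGroup.one_def, DihedralGroup.r.injEq, sub_eq_zero] at ht
      rw [hi, hj, ht]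
    have huvφ : φ (u * v) * ρ ^ t = 1 := by
      rw [map_mul, hi, hj, ← ht, DihedralGroup.sr_mul_sr, DihedralGroup.r_mul_r]
      simp
    have hvuφ : φ (v * u) = ρ ^ t := by
      rw [map_mul, hi, hj, DihedralGroup.sr_mul_sr, ht]
    have hlen : ∀ (l : List (Gns n s)) (k : ℕ), (l : Multiset (Gns n s)) = {u, v} →
        k ≤ R.card → φ l.prod * ρ ^ k = 1 → q ≤ k + 2 := by
      intro l k hl hk h1
      have hl2 : l.length = 2 := by
        rw [← Multiset.coe_card, hl]; rfl
      have hsub : ((R.toList.take k : List _) : Multiset (Gns n s)) ≤ R :=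
        (coe_le_coe_of_sublist (List.take_sublist _ _)).trans (by simp)
      have := hshort (l ++ R.toList.take k) (by intro h0; simp at h0; simp [h0] at hl2) (by
        rw [← Multiset.coe_add, hl, add_comm]
        exact add_le_add hsub huv) (by
        have hmap : (R.toList.take k).map φ = List.replicate k ρ := by
          have := List.eq_replicate_of_mem (l := (R.toList.take k).map φ) (a := ρ) (by
            intro b hb
            obtain ⟨g, hg, rfl⟩ := List.mem_map.1 hb
            exact hRρ g (Multiset.mem_of_le hsub hg))
          simpa [Nat.min_eq_left hk] using this
        rw [List.prod_append, map_mul, map_list_prod φ (R.toList.take k), hmap,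
          List.prod_replicate, h1])
      simp [hl2, Nat.min_eq_left hk] at this
      omega
    -- The two orders of the reflections can be closed with `t` and with `q - t` rotations. Both
    -- blocks have length at least `q`, whence `q - 2 ≤ t ≤ 2`.
    have h1 := hlen [u, v] t rfl (by omega) (by simpa using huvφ)
    have h2 := hlen [v, u] (q - t) (Multiset.pair_comm v u) (by omega) (by
      simp only [List.prod_cons, List.prod_nil, mul_one]
      rw [hvuφ, ← pow_add, Nat.add_sub_cancel' htq.le, hρq])
    exact ⟨t, huvφ, hvuφ, by omega, h1⟩
  -- Four reflections would need `q ≥ 4`, as their images are distinct; then `t = 2` for every pair,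
  -- and `φ (a * b) = φ (a * c)` contradicts distinctness.
  have hF3 : F.card ≤ 3 := by
    by_contra hlt
    obtain ⟨T, hTF, hT⟩ := exists_le_card_eq (S := F) (k := 3) (by omega)
    obtain ⟨a, b, c, rfl⟩ := Multiset.card_eq_three.1 hT
    have hab : ({a, b} : Multiset (Gns n s)) ≤ F := le_trans (by
      exact Multiset.cons_le_cons _ (Multiset.cons_le_cons _ (Multiset.zero_le _))) hTF
    have hac : ({a, c} : Multiset (Gns n s)) ≤ F := le_trans (by
      exact Multiset.cons_le_cons _ (Multiset.le_cons_self _ _)) hTF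
    have hbc : ({b, c} : Multiset (Gns n s)) ≤ F := le_trans (by
      exact Multiset.le_cons_self _ _) hTF
    obtain ⟨t, ht, -, ht2, hqt⟩ := hblock a b hab
    obtain ⟨t', ht', -, ht2', hqt'⟩ := hblock a c hac
    refine hFdist b c hbc ?_
    rw [show t = t' by omega, ← ht', map_mul, map_mul] at ht
    exact mul_left_cancel (mul_right_cancel ht)
  obtain ⟨T₂, hT₂F, hT₂⟩ := exists_le_card_eq hF2
  obtain ⟨a, b, rfl⟩ := Multiset.card_eq_two.1 hT₂
  obtain ⟨t, habφ, hbaφ, ht2, hqt⟩ := hblock a b hT₂F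
  have hq4 : q = 3 ∨ q = 4 := by omega
  -- Reserves `q - 1` rotations `T` and finds `κ - 2` blocks disjoint from them. For `q = 4` the
  -- rotations suffice. For `q = 3` they may give only `κ - 3` blocks, and the missing one is made
  -- of `a`, `b` and one rotation.
  have hsplit : ∀ W ≤ R, n ≤ W.card + 5 → ∃ (T : Multiset (Gns n s)) (bs : List (List (Gns n s))),
      T + (bs.flatten : Multiset _) ≤ W + F ∧ T ≤ W ∧ T.card + 1 = q ∧ κ ≤ bs.length + 2 ∧
      (∀ c ∈ bs, c ≠ []) ∧ ∀ c ∈ bs, φ c.prod = 1 := by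
    intro W hWR hW
    obtain ⟨T, hTW, hT⟩ := exists_le_card_eq (S := W) (k := q - 1) (by omega)
    have hWT : (W - T).card = W.card - T.card := Multiset.card_sub hTW
    have hsubρ : ∀ g ∈ W - T, φ g = ρ := fun g hg =>
      hRρ g (Multiset.mem_of_le (tsub_le_self.trans hWR) hg)
    rcases hq4 with h3 | h4
    · have h3n : n = 3 * κ := by rw [h, h3]
      obtain ⟨w, hw⟩ := Multiset.card_pos_iff_exists_mem.1 (show 0 < (W - T).card by omega)
      obtain ⟨V, hV⟩ := Multiset.exists_cons_of_mem hw
      have hVc : V.card + 1 = (W - T).card := by rw [hV, Multiset.card_cons]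
      obtain ⟨bs, hbs, hble, hne, hb1⟩ := exists_equal_blocks φ (q := 3) (by norm_num)
        (h3 ▸ hρq) (κ - 3) (W := V) (by omega)
        (fun g hg => hsubρ g (by rw [hV]; exact Multiset.mem_cons_of_mem hg))
      have hwρ : φ w = ρ := hsubρ w hw
      obtain ⟨X, hX, hXF, hX1⟩ : ∃ X : List (Gns n s), X ≠ [] ∧
          (X : Multiset _) = {w} + {a, b} ∧ φ X.prod = 1 := by
        have ht : t = 1 ∨ t = 2 := by omega
        rcases ht with rfl | rfl
        · refine ⟨[a, b, w], by simp, ?_, ?_⟩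
          · rw [add_comm]; rfl
          · rw [← habφ, pow_one, ← hwρ, ← map_mul]; simp [mul_assoc]
        · refine ⟨[b, a, w], by simp, ?_, ?_⟩
          · rw [add_comm, Multiset.pair_comm]; rfl
          · have hρ3 : ρ ^ 3 = 1 := (congrArg (ρ ^ ·) h3).symm.trans hρq
            rw [← hρ3, pow_succ, ← hbaφ, ← hwρ, ← map_mul]; simp [mul_assoc]
      refine ⟨T, X :: bs, ?_, hTW, by omega, by simp; omega, by simpa [hX] using hne,
        by simpa [hX1] using hb1⟩
      rw [List.flatten_cons, ← Multiset.coe_add, hXF]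
      calc T + ({w} + {a, b} + (bs.flatten : Multiset (Gns n s)))
          ≤ T + ({w} + F + V) := by gcongr
        _ = T + (W - T) + F := by rw [hV, ← Multiset.singleton_add]; abel
        _ = W + F := by rw [add_tsub_cancel_of_le hTW]
    · have h4n : n = 4 * κ := by rw [h, h4]
      obtain ⟨bs, hbs, hble, hne, hb1⟩ := exists_equal_blocks φ (q := 4) (by norm_num)
        (h4 ▸ hρq) (κ - 2) (W := W - T) (by omega) hsubρ
      refine ⟨T, bs, ?_, hTW, by omega, by omega, hne, hb1⟩
      calc T + (bs.flatten : Multiset (Gns n s)) ≤ T + (W - T) := by gcongr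
        _ = W := by rw [add_tsub_cancel_of_le hTW]
        _ ≤ W + F := Multiset.le_add_right _ _
  have hReq : ∀ u v, ({u, v} : Multiset (Gns n s)) ≤ R → u = v := by
    intro u v huv
    obtain ⟨W, hW⟩ := Multiset.le_iff_exists_add.1 huv
    have hWR : W ≤ R := hW ▸ Multiset.le_add_left _ _
    have hWc : W.card + 2 = R.card := by rw [hW, Multiset.card_add, add_comm]; rfl
    obtain ⟨T, bs, hle, hTW, hTc, hκbs, hne, hb1⟩ := hsplit W hWR (by omega)
    have hprod : ∀ w ∈ R, φ (w :: T.toList).prod = 1 := by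
      intro w hw
      have := List.eq_replicate_of_mem (l := (w :: T.toList).map φ) (a := ρ) (by
        intro b hb
        obtain ⟨g, hg, rfl⟩ := List.mem_map.1 hb
        rcases List.mem_cons.1 hg with rfl | hg
        · exact hRρ _ hw
        · exact hRρ g (Multiset.mem_of_le (hTW.trans hWR) (Multiset.mem_toList.1 hg)))
      rw [map_list_prod, this, List.prod_replicate]
      simp [hTc, hρq]
    have hle' : ∀ w, ({w} : Multiset (Gns n s)) ≤ {u, v} →
        (((w :: T.toList) ++ bs.flatten : List _) : Multiset (Gns n s)) ≤ R + F := by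
      intro w hw
      rw [← Multiset.coe_add, ← Multiset.cons_coe, Multiset.coe_toList,
        ← Multiset.singleton_add, add_assoc, hW, add_assoc]
      exact add_le_add hw hle
    have hu : u ∈ R := Multiset.mem_of_le huv (by simp)
    have hv : v ∈ R := Multiset.mem_of_le huv (by simp)
    -- Adding `u` or `v` to `T` completes a block beside the same `κ - 2` blocks, so the two
    -- products agree and `T` cancels.
    have := hS.block_prod_unique (Subgroup.zpowers (genY n s ^ q))
      (hle' u (by simp)) (hle' v (by simp)) (by simp) (by simp) hne
      (mem_zpowers_of_toDihedral_eq_one hqn hqs (hprod u hu))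
      (mem_zpowers_of_toDihedral_eq_one hqn hqs (hprod v hv))
      (fun c hc => mem_zpowers_of_toDihedral_eq_one hqn hqs (hb1 c hc))
      (by rw [card_kernel (by omega) hs h]; exact hκbs)
    simpa using this
  have hRh := eq_replicate_of_pairs hReq hh₀
  have ho := orderOf_eq_of_replicate_le hn hS (k := R.card) (by omega)
    (hRh ▸ Multiset.le_add_right _ _) (zpow_pow_eq_one (hR h₀ hh₀))
  have hp := isPresentedBy_of_mem_zpowers (by omega) hs hs1 (hR h₀ hh₀) ho
  have hle : Subgroup.zpowers h₀ ≤ Subgroup.zpowers (genY n s) :=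
    Subgroup.zpowers_le.2 (hR h₀ hh₀)
  refine hp.not_productOneFree hn hs hs1 hs2 (γ := a) (δ := b)
    (fun h => hF a (Multiset.mem_of_le hT₂F (by simp)) (hle h))
    (fun h => hF b (Multiset.mem_of_le hT₂F (by simp)) (hle h)) (k := R.card) (by omega)
    (hS.mono ?_)
  rw [← hRh]
  gcongr

end LargeQuotient

/-- Over a group of exponent two, a sequence splits into terms in the kernel, pairs of terms with
the same image, and a rest whose terms have distinct images. -/
theorem exists_pairing {G H : Type*} [Group G] [Group H] (f : G →* H) (S : Multiset G) :
    ∃ (os : List G) (ps : List (List G)) (R : Multiset G),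
      S = (os : Multiset G) + (ps.flatten : Multiset G) + R ∧ (∀ g ∈ os, f g = 1) ∧
      (∀ b ∈ ps, ∃ u v, b = [u, v] ∧ f u = f v ∧ f u ≠ 1) ∧
      (R.map f).Nodup ∧ ∀ g ∈ R, f g ≠ 1 := by
  classical
  induction S using Multiset.induction with
  | empty => exact ⟨[], [], 0, by simp⟩
  | cons g S ih =>
    obtain ⟨os, ps, R, rfl, ho, hp, hR, hR1⟩ := ih
    by_cases hg : f g = 1
    · exact ⟨g :: os, ps, R, by simp [← Multiset.cons_coe], by simpa [hg] using ho, hp, hR, hR1⟩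
    by_cases hex : ∃ w ∈ R, f w = f g
    · obtain ⟨w, hw, hwg⟩ := hex
      obtain ⟨R', rfl⟩ := Multiset.exists_cons_of_mem hw
      refine ⟨os, [g, w] :: ps, R', ?_, ho, ?_, ?_, fun a ha => hR1 a (by simp [ha])⟩
      · rw [List.flatten_cons, ← Multiset.coe_add, ← Multiset.cons_coe, ← Multiset.cons_coe,
          Multiset.coe_nil, Multiset.cons_zero, ← Multiset.singleton_add,
          ← Multiset.singleton_add, ← Multiset.singleton_add]
        abel
      · intro b hb
        rcases List.mem_cons.1 hb with rfl | hb
        · exact ⟨g, w, rfl, hwg.symm, hg⟩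
        · exact hp b hb
      · rw [Multiset.map_cons] at hR
        exact (Multiset.nodup_cons.1 hR).2
    · push Not at hex
      refine ⟨os, ps, g ::ₘ R, by rw [← Multiset.singleton_add, ← Multiset.singleton_add]; abel,
        ho, hp, ?_, by simpa [hg] using hR1⟩
      rw [Multiset.map_cons, Multiset.nodup_cons]
      refine ⟨fun h => ?_, hR⟩
      obtain ⟨w, hw, hwg⟩ := Multiset.mem_map.1 h
      exact hex w hw hwg

/-! ### The case `q = 2`: the Klein four quotient. -/

section KleinFour

theorem klein_mul_self : ∀ a : DihedralGroup 2, a * a = 1 := by decide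

theorem klein_mul_mul : ∀ a b c : DihedralGroup 2, a ≠ 1 → b ≠ 1 → c ≠ 1 → a ≠ b → a ≠ c →
    b ≠ c → a * (b * c) = 1 := by decide

theorem klein_card_le {R : Multiset (DihedralGroup 2)} (hR : R.Nodup) (h : ∀ g ∈ R, g ≠ 1) :
    R.card ≤ 3 := by
  classical
  rw [← Multiset.toFinset_card_of_nodup hR]
  have : R.toFinset ⊆ Finset.univ.erase 1 := fun g hg =>
    Finset.mem_erase.2 ⟨h g (Multiset.mem_toFinset.1 hg), Finset.mem_univ _⟩
  exact (Finset.card_le_card this).trans (by decide)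

end KleinFour

section IndexFourKernel

variable {n κ : ℕ} {s : ℤ}

theorem odd_of_intCast_ne_zero {i : ℤ} (hi : (i : ZMod 2) ≠ 0) : Odd i := by
  rw [← Int.not_even_iff_odd, even_iff_two_dvd]
  intro hd
  exact hi ((ZMod.intCast_zmod_eq_zero_iff_dvd i 2).2 hd)

/-- The hypotheses on `n` and `s` when `s ≡ 1 + n / 2`. -/
structure IsHalfTwist (n κ : ℕ) (s : ℤ) : Prop where
  eq : n = 2 * κ
  le : 8 ≤ n
  sq : s ^ 2 ≡ 1 [ZMOD n]
  exists_odd : ∃ t : ℤ, s - 1 = κ * t ∧ Odd t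
  even : Even κ

namespace IsHalfTwist

variable (h : IsHalfTwist n κ s)
include h

theorem two_dvd : 2 ∣ n := ⟨κ, h.eq⟩

theorem two_dvd_add_one : ((2 : ℕ) : ℤ) ∣ s + 1 := by
  obtain ⟨t, ht, -⟩ := h.exists_odd
  obtain ⟨m, hm⟩ := h.even
  exact ⟨m * t + 1, by rw [hm] at ht; push_cast at ht ⊢; linarith⟩

theorem genY_zpow_mul_eq {i j : ℤ} (hij : Even (i - j)) :
    genY n s ^ (κ * i) = genY n s ^ (κ * j) := by
  obtain ⟨m, hm⟩ := hij
  apply genY_zpow_congr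
  rw [h.eq]
  exact Int.modEq_iff_dvd.2 ⟨-m, by push_cast; linear_combination (-(κ : ℤ)) * hm⟩

theorem genY_zpow_mul_odd {i : ℤ} (hi : Odd i) : genY n s ^ (κ * i) = genY n s ^ κ := by
  rw [h.genY_zpow_mul_eq (i := i) (j := 1) (hi.sub_odd odd_one), mul_one, zpow_natCast]

theorem genY_zpow_mul_even {i : ℤ} (hi : Even i) : genY n s ^ (κ * i) = 1 := by
  rw [h.genY_zpow_mul_eq (i := i) (j := 0) (by simpa using hi), mul_zero, zpow_zero]

theorem centralElement_sq : genY n s ^ κ * genY n s ^ κ = 1 := by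
  rw [← pow_add, ← two_mul, ← h.eq, genY_pow]

theorem centralElement_ne_one : genY n s ^ κ ≠ 1 := by
  intro h1
  have := orderOf_dvd_of_pow_eq_one h1
  rw [orderOf_genY h.sq] at this
  have h2 := Nat.le_of_dvd (by have := h.eq; have := h.le; omega) this
  have := h.eq; have := h.le
  omega

/-- The map to the Klein four-group. -/
def toKlein : Gns n s →* DihedralGroup 2 := toDihedral h.two_dvd h.two_dvd_add_one

theorem toKlein_rot (i : ℤ) : h.toKlein (genY n s ^ i) = DihedralGroup.r (i : ZMod 2) :=
  toDihedral_rot _ _ i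

theorem toKlein_refl (i : ℤ) :
    h.toKlein (genX n s * genY n s ^ i) = DihedralGroup.sr (i : ZMod 2) :=
  toDihedral_refl _ _ i

theorem mem_kernel {g : Gns n s} (hg : h.toKlein g = 1) :
    g ∈ Subgroup.zpowers (genY n s ^ 2) :=
  mem_zpowers_of_toDihedral_eq_one _ _ hg

theorem card_kernel : Nat.card (Subgroup.zpowers (genY n s ^ 2)) = κ :=
  ZeroSum.card_kernel (by have := h.le; omega) h.sq h.eq

theorem zpow_comm_refl {i : ℤ} (j : ℤ) (hi : Odd i) :
    genY n s ^ (s * i + j) = genY n s ^ (j + i) * genY n s ^ κ := by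
  obtain ⟨t, ht, hto⟩ := h.exists_odd
  rw [show s * i + j = (j + i) + κ * (t * i) by linear_combination i * ht, zpow_add,
    h.genY_zpow_mul_odd (hto.mul hi)]

/-- Elements with distinct nontrivial images commute up to the central involution. -/
theorem mul_eq_mul_mul {u v : Gns n s} (hu : h.toKlein u ≠ 1) (hv : h.toKlein v ≠ 1)
    (huv : h.toKlein u ≠ h.toKlein v) : u * v = v * u * genY n s ^ κ := by
  obtain ⟨i, rfl | rfl⟩ := eq_rot_or_refl u <;> obtain ⟨j, rfl | rfl⟩ := eq_rot_or_refl v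
  · rw [h.toKlein_rot, DihedralGroup.one_def, Ne, DihedralGroup.r.injEq] at hu hv
    rw [h.toKlein_rot, h.toKlein_rot, Ne, DihedralGroup.r.injEq] at huv
    exfalso
    revert hu hv huv
    generalize (i : ZMod 2) = a
    generalize (j : ZMod 2) = b
    revert a b
    decide
  · rw [h.toKlein_rot, DihedralGroup.one_def, Ne, DihedralGroup.r.injEq] at hu
    rw [rot_mul_refl, refl_mul_rot, h.zpow_comm_refl j (odd_of_intCast_ne_zero hu), mul_assoc]
  · rw [h.toKlein_rot, DihedralGroup.one_def, Ne, DihedralGroup.r.injEq] at hv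
    rw [rot_mul_refl, refl_mul_rot, mul_assoc,
      h.zpow_comm_refl i (odd_of_intCast_ne_zero hv), mul_assoc (genY n s ^ (i + j)),
      h.centralElement_sq, mul_one]
  · rw [h.toKlein_refl, h.toKlein_refl, Ne, DihedralGroup.sr.injEq] at huv
    have hodd : Odd (i - j) := odd_of_intCast_ne_zero (by
      push_cast
      exact sub_ne_zero.2 huv)
    obtain ⟨t, ht, hto⟩ := h.exists_odd
    rw [refl_mul_refl, refl_mul_refl, ← h.genY_zpow_mul_odd (hto.mul hodd), ← zpow_add]
    congr 1
    linear_combination (i - j) * ht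

theorem commute_centralElement (g : Gns n s) : genY n s ^ κ * g = g * genY n s ^ κ := by
  have hx : genY n s ^ κ * genX n s = genX n s * genY n s ^ κ := by
    have hs : Odd s := by
      obtain ⟨m, hm⟩ := h.two_dvd_add_one
      exact ⟨m - 1, by push_cast at hm; linarith⟩
    rw [← zpow_natCast, zpow_genY_mul_genX, mul_comm s, h.genY_zpow_mul_odd hs, zpow_natCast]
  obtain ⟨i, rfl | rfl⟩ := eq_rot_or_refl g
  · rw [← zpow_natCast, zpow_mul_comm]
  · rw [← mul_assoc, hx, mul_assoc, mul_assoc, ← zpow_natCast, zpow_mul_comm]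

theorem sq_mem_kernel (g : Gns n s) : g ^ 2 ∈ Subgroup.zpowers (genY n s ^ 2) :=
  h.mem_kernel (by rw [map_pow, pow_two, klein_mul_self])

theorem pow_eq_one (g : Gns n s) : g ^ n = 1 := by
  obtain ⟨i, hi⟩ := h.sq_mem_kernel g
  have hi : (genY n s ^ 2) ^ i = g ^ 2 := hi
  have h1 : (genY n s ^ 2) ^ κ = 1 := by rw [← pow_mul, ← h.eq, genY_pow]
  have h2 : g ^ n = (g ^ 2) ^ κ := by
    rw [← pow_mul]; exact congrArg (g ^ ·) h.eq
  rw [h2, ← hi, ← zpow_natCast, ← zpow_mul, mul_comm, zpow_mul, zpow_natCast, h1, one_zpow]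

/-- Here an element `β = x * y ^ a` outside `⟨y⟩` may also have order `n`. Then `β ^ κ` is the
central involution `y ^ κ` and `a` is odd, so `β * x = x * β * y ^ κ = x * β ^ s`, and `x` serves as
`α`. It is not in `⟨β⟩` because it does not commute with `β`. -/
theorem exists_isPresentedBy (hs1 : ¬ s ≡ 1 [ZMOD n]) {β : Gns n s} (hβ : orderOf β = n) :
    ∃ α, IsPresentedBy n s α β := by
  have hn0 : 0 < n := by have := h.le; omega
  obtain ⟨a, ha | ha⟩ := eq_rot_or_refl β
  · exact ⟨_, isPresentedBy_of_mem_zpowers hn0 h.sq hs1 (ha ▸ Subgroup.zpow_mem_zpowers _ _) hβ⟩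
  obtain ⟨t, ht, hto⟩ := h.exists_odd
  obtain ⟨μ, hμ⟩ := h.even
  have hβ2 : β ^ 2 = genY n s ^ (s * a + a) := by rw [ha, pow_two, refl_mul_refl]
  have hβκ : β ^ κ = genY n s ^ (κ * (t * a * μ + a)) := by
    have : κ = 2 * μ := by omega
    have h2 : β ^ κ = (β ^ 2) ^ μ := by rw [this, pow_mul]
    rw [h2, hβ2, ← zpow_natCast, ← zpow_mul]
    congr 1
    have : (κ : ℤ) = 2 * μ := by exact_mod_cast this
    linear_combination a * μ * ht - a * this
  have hβκ1 : β ^ κ ≠ 1 := by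
    intro h1
    have := orderOf_dvd_of_pow_eq_one h1
    rw [hβ] at this
    have h2 := Nat.le_of_dvd (by have := h.eq; omega) this
    have := h.eq
    omega
  have hβz : β ^ κ = genY n s ^ κ := by
    rcases Int.even_or_odd (t * a * μ + a) with he | ho
    · exact absurd (hβκ.trans (h.genY_zpow_mul_even he)) hβκ1
    · rw [hβκ, h.genY_zpow_mul_odd ho]
  have hodd : Odd a := by
    rw [← Int.not_even_iff_odd]
    intro he
    refine hβκ1 (hβκ.trans (h.genY_zpow_mul_even ?_))
    rw [mul_assoc, mul_left_comm]
    exact (he.mul_right _).add he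
  have hcomm : β * genX n s = genX n s * β * genY n s ^ κ := by
    have hx : h.toKlein (genX n s) = DihedralGroup.sr 0 := by
      simpa using h.toKlein_refl 0
    have hb : h.toKlein β = DihedralGroup.sr (a : ZMod 2) := by rw [ha, h.toKlein_refl]
    have ha1 : (a : ZMod 2) ≠ 0 := by
      rw [Ne, ZMod.intCast_zmod_eq_zero_iff_dvd]
      rw [← Int.not_even_iff_odd, even_iff_two_dvd] at hodd
      exact hodd
    refine h.mul_eq_mul_mul ?_ ?_ ?_
    · rw [hb]; intro h1; cases h1
    · rw [hx]; intro h1; cases h1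
    · rw [hb, hx]; intro h1; exact ha1 (by simpa using h1)
  refine ⟨genX n s, isPresentedBy_of_relations hn0 (genX_sq n s) ?_ hβ ?_⟩
  · obtain ⟨m, hm⟩ := hto
    have hst : s = 1 + κ * t := by linarith
    have : β ^ s = β * genY n s ^ κ := by
      rw [congrArg (β ^ ·) hst, zpow_add, zpow_one, zpow_mul, zpow_natCast, hβz, ← zpow_natCast, ← zpow_mul,
        h.genY_zpow_mul_odd ⟨m, hm⟩, zpow_natCast]
    rw [hcomm, this, mul_assoc]
  · rintro ⟨j, hj⟩
    have hj : β ^ j = genX n s := hj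
    refine h.centralElement_ne_one ?_
    rw [← hj] at hcomm
    rw [← zpow_one_add, add_comm, zpow_add_one] at hcomm
    exact (mul_eq_left.1 hcomm.symm)

/-- Many terms with the same nontrivial image in the Klein four-group are all equal. -/
theorem eq_of_same_image {S T : Multiset (Gns n s)} (hS : ProductOneFree S) (hTS : T ≤ S)
    (hT : n ≤ T.card + 2) {τ : DihedralGroup 2} (hτ : ∀ g ∈ T, h.toKlein g = τ) {u u' : Gns n s}
    (huu : ({u, u'} : Multiset (Gns n s)) ≤ T) : u = u' := by
  have hn := h.le
  have hnκ := h.eq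
  have hfin := finite_Gns (s := s) (show 0 < n by omega)
  have hκ4 : 4 ≤ κ := by omega
  obtain ⟨W, hW⟩ := Multiset.le_iff_exists_add.1 huu
  have hWc : T.card = 2 + W.card := by rw [hW, Multiset.card_add]; rfl
  obtain ⟨P, hP, hPc⟩ := exists_le_card_eq (S := W) (k := 2) (by omega)
  obtain ⟨v, v', rfl⟩ := Multiset.card_eq_two.1 hPc
  obtain ⟨V, rfl⟩ := Multiset.le_iff_exists_add.1 hP
  have hVc : ({v, v'} + V : Multiset (Gns n s)).card = 2 + V.card := by
    rw [Multiset.card_add]; rfl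
  have hτ2 : τ ^ 2 = 1 := by rw [pow_two, klein_mul_self]
  obtain ⟨bs, hbs, hble, hne, hb1⟩ := exists_equal_blocks h.toKlein (q := 2) (by norm_num) hτ2
    (κ - 3) (W := V) (by omega) (fun g hg => hτ g (by
      rw [hW]; exact Multiset.mem_add.2 (Or.inr (Multiset.mem_add.2 (Or.inr hg)))))
  obtain ⟨c, cs, rfl⟩ : ∃ c cs, bs = c :: cs := by
    cases bs with
    | nil => simp at hbs; omega
    | cons c cs => exact ⟨c, cs, rfl⟩
  have hmem : ∀ g ∈ ({u, u', v, v'} : Multiset (Gns n s)), h.toKlein g = τ := by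
    intro g hg
    apply hτ
    rw [hW, ← add_assoc]
    exact Multiset.mem_add.2 (Or.inl hg)
  have hpair : ∀ a b, a ∈ ({u, u', v, v'} : Multiset (Gns n s)) →
      b ∈ ({u, u', v, v'} : Multiset (Gns n s)) → h.toKlein [a, b].prod = 1 := by
    intro a b ha hb
    simp only [List.prod_cons, List.prod_nil, mul_one, map_mul]
    rw [hmem a ha, hmem b hb, klein_mul_self]
  -- The pairs `[a, v]`, `[a', v']` and the `κ - 3` others reach the maximal number of blocks, so `a
  -- * v` equals the product of the untouched block `c`. Exchanging `u` and `u'` gives `u * v = u' *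
  -- v`.
  have key : ∀ a a', (({a, v, a', v'} : Multiset (Gns n s)) = {u, u'} + {v, v'}) →
      a * v = c.prod := by
    intro a a' haa
    have haa' : ({a, v, a', v'} : Multiset (Gns n s)) = {u, u', v, v'} := haa
    have ha : a ∈ ({u, u', v, v'} : Multiset (Gns n s)) := by rw [← haa']; simp
    have ha' : a' ∈ ({u, u', v, v'} : Multiset (Gns n s)) := by rw [← haa']; simp
    have := hS.blocks_prod_eq (Subgroup.zpowers (genY n s ^ 2)) (zpowers_comm _)
      (b := [a, v]) (b' := c) (bs := [a', v'] :: cs) ?_ ?_ ?_ ?_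
    · simpa using this
    · refine le_trans (le_of_eq ?_) (le_trans (add_le_add_right hble ({a, v, a', v'})) ?_)
      · have e : ({a, v, a', v'} : Multiset (Gns n s)) =
            (([a, v] : List (Gns n s)) : Multiset (Gns n s)) +
              (([a', v'] : List (Gns n s)) : Multiset (Gns n s)) := rfl
        rw [e]
        simp only [List.flatten_cons, ← Multiset.coe_add]
        abel
      · rw [haa, add_assoc, ← hW]
        exact hTS
    · simpa using hne
    · intro d hd
      apply h.mem_kernel
      simp only [List.mem_cons] at hd
      rcases hd with rfl | rfl | rfl | hd
      · exact hpair _ _ ha (by simp)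
      · exact hb1 _ (by simp)
      · exact hpair _ _ ha' (by simp)
      · exact hb1 _ (by simp [hd])
    · rw [h.card_kernel]
      simp at hbs ⊢
      omega
  have h1 := key u u' (by
    simp only [Multiset.insert_eq_cons, ← Multiset.singleton_add]; abel)
  have h2 := key u' u (by
    simp only [Multiset.insert_eq_cons, ← Multiset.singleton_add]; abel)
  exact mul_right_cancel (h1.trans h2.symm)

/-- In a maximal collection of disjoint pairs, all pairs have the same image. -/
theorem pairs_same_image {S : Multiset (Gns n s)} (hS : ProductOneFree S)
    {u v u' v' : Gns n s} {ps : List (List (Gns n s))}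
    (hle : (([u, v] :: [u', v'] :: ps).flatten : Multiset (Gns n s)) ≤ S)
    (hlen : ps.length + 3 = κ) (huv : h.toKlein u = h.toKlein v)
    (huv' : h.toKlein u' = h.toKlein v') (hu : h.toKlein u ≠ 1) (hu' : h.toKlein u' ≠ 1)
    (hps : ∀ b ∈ ps, b ≠ [] ∧ h.toKlein b.prod = 1) : h.toKlein u = h.toKlein u' := by
  classical
  by_contra hne
  have hn := h.le
  have hnκ := h.eq
  have hfin := finite_Gns (s := s) (show 0 < n by omega)
  have hcard := h.card_kernel
  set K := Subgroup.zpowers (genY n s ^ 2) with hKdef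
  set g := u * v with hg
  have hall : ∀ b ∈ [u, v] :: [u', v'] :: ps, b ≠ [] ∧ h.toKlein b.prod = 1 := by
    intro b hb
    simp only [List.mem_cons] at hb
    rcases hb with rfl | rfl | hb
    · simp [huv, klein_mul_self]
    · simp [huv', klein_mul_self]
    · exact hps b hb
  have hgK : g ∈ K := by
    have := h.mem_kernel (hall [u, v] (by simp)).2
    simpa using this
  -- There are `κ - 1` blocks, so rigidity applies to any of them once it is moved next to `[u, v]`.
  -- Consequently `g` generates the kernel.
  have hprod : ∀ b ∈ [u', v'] :: ps, b.prod = g := by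
    intro b hb
    have hperm : ([u, v] :: [u', v'] :: ps).Perm ([u, v] :: b :: ([u', v'] :: ps).erase b) :=
      (List.perm_cons_erase hb).cons _
    have := hS.blocks_prod_eq K (zpowers_comm _) (b := [u, v]) (b' := b)
      (bs := ([u', v'] :: ps).erase b)
      (le_trans (Multiset.coe_le.2 hperm.symm.flatten.subperm) hle)
      (fun c hc => (hall c (hperm.mem_iff.2 hc)).1)
      (fun c hc => h.mem_kernel (hall c (hperm.mem_iff.2 hc)).2)
      (by rw [hcard, List.length_erase_of_mem hb, List.length_cons]; omega)
    rw [← this]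
    simp [hg]
  have hmapg : ([u, v] :: [u', v'] :: ps).map List.prod = List.replicate (ps.length + 2) g := by
    have := List.eq_replicate_of_mem (l := ([u, v] :: [u', v'] :: ps).map List.prod) (a := g) (by
      intro x hx
      obtain ⟨b, hb, rfl⟩ := List.mem_map.1 hx
      rcases List.mem_cons.1 hb with rfl | hb
      · simp [hg]
      · exact hprod b hb)
    simpa using this
  have hgpow : ∀ j, 0 < j → j < κ → g ^ j ≠ 1 := by
    intro j hj hjκ
    have := hS.sublist_map_prod hle (fun b hb => (hall b hb).1) (List.replicate j g)
      (by simp; omega) (by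
        rw [hmapg]
        exact (List.replicate_sublist_replicate g).2 (by omega))
    simpa using this
  have hκ0 : 0 < κ := by omega
  have hgκ : g ^ κ = 1 := by
    have : (⟨g, hgK⟩ : K) ^ Nat.card K = 1 := pow_card_eq_one'
    rw [hcard] at this
    simpa using congrArg Subtype.val this
  have hord : orderOf g = κ := (orderOf_eq_iff hκ0).2 ⟨hgκ, fun j hj hj0 => hgpow j hj0 hj⟩
  have hKg : Subgroup.zpowers g = K := Subgroup.eq_of_le_of_card_ge (Subgroup.zpowers_le.2 hgK)
    (by rw [hcard, Nat.card_zpowers, hord])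
  obtain ⟨μ, hμ⟩ := h.even
  have hzK : genY n s ^ κ ∈ Subgroup.zpowers g := by
    rw [hKg]
    exact ⟨μ, by
      change (genY n s ^ 2) ^ (μ : ℤ) = _
      rw [zpow_natCast, ← pow_mul, hμ, two_mul]⟩
  rw [mem_zpowers_iff_mem_range_orderOf, hord] at hzK
  obtain ⟨i, hi, hiz⟩ := Finset.mem_image.1 hzK
  rw [Finset.mem_range] at hi
  have hi0 : i ≠ 0 := by
    rintro rfl
    exact h.centralElement_ne_one (by rw [← hiz, pow_zero])
  -- With `0 < i < κ` this gives `i ≤ κ - 2`, so `κ - 2 - i` is a true difference; `i ≠ 0` keeps it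
  -- within the `κ - 3` pairs of `ps`.
  have hiκ : i + 1 ≠ κ := by
    intro he
    have h1 := h.centralElement_sq
    rw [← hiz, ← pow_add, show i + i = (κ - 2) + κ by omega, pow_add, hgκ, mul_one] at h1
    exact hgpow (κ - 2) (by omega) (by omega) h1
  have hcomm := h.mul_eq_mul_mul hu' (huv ▸ hu) (by rw [← huv]; exact Ne.symm hne)
  have hg' : u' * v' = g := by simpa using hprod [u', v'] (by simp)
  have hquad : u * (u' * (v * v')) = g ^ (i + 2) := by
    calc u * (u' * (v * v')) = u * (u' * v) * v' := by group
      _ = u * v * u' * (genY n s ^ κ * v') := by rw [hcomm]; group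
      _ = (u * v) * (u' * v') * genY n s ^ κ := by rw [h.commute_centralElement]; group
      _ = g ^ (i + 2) := by rw [hg', ← hiz, ← hg, ← pow_two, ← pow_add, add_comm]
  have hmapps : (ps.take (κ - 2 - i)).map List.prod = List.replicate (κ - 2 - i) g := by
    have := List.eq_replicate_of_mem (l := (ps.take (κ - 2 - i)).map List.prod) (a := g) (by
      intro x hx
      obtain ⟨b, hb, rfl⟩ := List.mem_map.1 hx
      exact hprod b (List.mem_cons_of_mem _ (List.mem_of_mem_take hb)))
    simpa [show min (κ - 2 - i) ps.length = κ - 2 - i by omega] using this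
  -- Interleaving the two pairs multiplies `g ^ 2` by `y ^ κ = g ^ i`. The remaining pairs, each of
  -- product `g`, fill the exponent up to `κ`.
  refine hS ([u, u', v, v'] ++ (ps.take (κ - 2 - i)).flatten) (by simp) ?_ ?_
  · refine le_trans ?_ hle
    have e : (([u, u', v, v'] : List _) : Multiset (Gns n s)) =
        (([u, v] : List (Gns n s)) : Multiset (Gns n s)) +
          (([u', v'] : List (Gns n s)) : Multiset (Gns n s)) := by
      change ({u, u', v, v'} : Multiset (Gns n s)) = {u, v} + {u', v'}
      simp only [Multiset.insert_eq_cons, ← Multiset.singleton_add]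
      abel
    rw [← Multiset.coe_add, e, List.flatten_cons, List.flatten_cons, ← Multiset.coe_add,
      ← Multiset.coe_add, ← add_assoc]
    exact add_le_add le_rfl (coe_le_coe_of_sublist (List.take_sublist _ _).flatten)
  · rw [List.prod_append, List.prod_flatten, hmapps, List.prod_replicate]
    simp only [List.prod_cons, List.prod_nil, mul_one]
    rw [hquad, ← pow_add, show i + 2 + (κ - 2 - i) = κ by omega, hgκ]

end IsHalfTwist
end IndexFourKernel

/-! ### The structure of product-one free sequences of length `n`, and the bound on `η`. -/

section Inverse

variable {n κ : ℕ} {s : ℤ}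

theorem length_flatten_pairs {G : Type*} {ps : List (List G)} (h : ∀ b ∈ ps, b.length = 2) :
    ps.flatten.length = ps.length * 2 := by
  rw [List.length_flatten, List.eq_replicate_of_mem (l := ps.map List.length) (a := 2) (by
    intro x hx
    obtain ⟨b, hb, rfl⟩ := List.mem_map.1 hx
    exact h b hb)]
  simp

theorem IsHalfTwist.isExtremal (h : IsHalfTwist n κ s) (hs1 : ¬ s ≡ 1 [ZMOD n])
    (hs2 : ¬ s ≡ -1 [ZMOD n]) {S : Multiset (Gns n s)} (hS : ProductOneFree S)
    (hcard : S.card = n) : IsExtremal n s S := by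
  classical
  have hn := h.le
  have hnκ := h.eq
  have hfin := finite_Gns (s := s) (show 0 < n by omega)
  obtain ⟨os, ps, R, rfl, ho, hp, hRn, hR1⟩ := exists_pairing h.toKlein S
  have hp2 : ∀ b ∈ ps, b ≠ [] ∧ h.toKlein b.prod = 1 := by
    intro b hb
    obtain ⟨u, v, rfl, huv, -⟩ := hp b hb
    simp [huv, klein_mul_self]
  have hpl : ps.flatten.length = ps.length * 2 := length_flatten_pairs fun b hb => by
    obtain ⟨u, v, rfl, -⟩ := hp b hb
    rfl
  have hc : os.length + ps.length * 2 + R.card = n := by simpa [hpl] using hcard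
  have hR3 : R.card ≤ 3 := by
    have := klein_card_le hRn (by simpa using hR1)
    simpa using this
  -- Kernel terms and pairs are all blocks. As `n = 2 * κ`, fewer than `κ` blocks leave room only
  -- for no kernel term, `κ - 1` pairs and two leftovers; three leftovers would form one more block.
  have hbound : ∀ cs : List (List (Gns n s)), (cs.flatten : Multiset _) ≤ R →
      (∀ c ∈ cs, c ≠ [] ∧ h.toKlein c.prod = 1) → os.length + ps.length + cs.length + 1 ≤ κ := by
    intro cs hcs hc1
    have hall : ∀ b ∈ os.map (fun g => [g]) ++ ps ++ cs, b ≠ [] ∧ h.toKlein b.prod = 1 := by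
      intro b hb
      rcases List.mem_append.1 hb with hb | hb
      · rcases List.mem_append.1 hb with hb | hb
        · obtain ⟨g, hg, rfl⟩ := List.mem_map.1 hb
          simp [ho g hg]
        · exact hp2 b hb
      · exact hc1 b hb
    have := hS.length_blocks_lt (Subgroup.zpowers (genY n s ^ 2))
      (bs := os.map (fun g => [g]) ++ ps ++ cs) (by
        rw [List.flatten_append, List.flatten_append, ← Multiset.coe_add, ← Multiset.coe_add]
        have hos : (os.map (fun g => [g])).flatten = os := by
          rw [← List.flatMap_def]; simp
        rw [hos]
        gcongr) (fun b hb => (hall b hb).1) (fun b hb => h.mem_kernel (hall b hb).2)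
    rw [h.card_kernel] at this
    simpa [add_assoc] using this
  have hRne3 : R.card ≠ 3 := by
    intro h3
    obtain ⟨a, b, c, rfl⟩ := Multiset.card_eq_three.1 h3
    have := hbound [[a, b, c]] (le_of_eq (by simp; rfl)) (by
      simp only [List.mem_singleton, forall_eq, map_mul, List.prod_cons, List.prod_nil, mul_one]
      simp only [Multiset.insert_eq_cons, Multiset.map_cons, Multiset.map_singleton,
        Multiset.nodup_cons, Multiset.mem_cons, Multiset.mem_singleton, not_or] at hRn
      exact ⟨by simp, klein_mul_mul _ _ _ (hR1 a (by simp)) (hR1 b (by simp)) (hR1 c (by simp))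
        hRn.1.1 hRn.1.2 hRn.2.1⟩)
    simp at this
    omega
  have h0 := hbound [] (by simp) (by simp)
  rw [List.length_nil] at h0
  have hos : os = [] := List.length_eq_zero_iff.1 (by omega)
  subst hos
  rw [List.length_nil] at hc h0
  obtain ⟨r₁, r₂, rfl⟩ := Multiset.card_eq_two.1 (show R.card = 2 by omega)
  have hr12 : h.toKlein r₁ ≠ h.toKlein r₂ := by
    simpa using hRn
  have hr1 := hR1 r₁ (by simp)
  have hr2 := hR1 r₂ (by simp)
  rw [Multiset.coe_nil, zero_add] at hS hcard ⊢
  have hpsc : ps.length + 1 = κ := by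
    simp at hc
    omega
  obtain ⟨b₀, ps', rfl⟩ : ∃ b ps', ps = b :: ps' := by
    cases ps with
    | nil => simp at hpsc; omega
    | cons b ps' => exact ⟨b, ps', rfl⟩
  obtain ⟨u, v, rfl, huv, hu1⟩ := hp b₀ (by simp)
  set τ := h.toKlein u with hτ
  -- All pairs have the same image.
  have hps : ∀ b ∈ ps', ∀ w ∈ b, h.toKlein w = τ := by
    intro b hb w hw
    obtain ⟨u', v', rfl, huv', hu1'⟩ := hp b (by simp [hb])
    have hperm : ([u, v] :: ps').Perm ([u, v] :: [u', v'] :: ps'.erase [u', v']) :=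
      (List.perm_cons_erase hb).cons _
    have := h.pairs_same_image hS (u := u) (v := v) (u' := u') (v' := v')
      (ps := ps'.erase [u', v'])
      ((Multiset.coe_le.2 hperm.symm.flatten.subperm).trans (Multiset.le_add_right _ _))
      (by rw [List.length_erase_of_mem hb]; simp at hpsc; omega) huv huv' hu1 hu1'
      (fun c hc => hp2 c (by simp [List.mem_of_mem_erase hc]))
    simp only [List.mem_cons, List.not_mem_nil, or_false] at hw
    rcases hw with rfl | rfl
    · exact this.symm
    · exact huv'.symm.trans this.symm
  have hflat : ∀ w ∈ ([u, v] :: ps').flatten, h.toKlein w = τ := by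
    intro w hw
    obtain ⟨b, hb, hwb⟩ := List.mem_flatten.1 hw
    rcases List.mem_cons.1 hb with rfl | hb
    · simp only [List.mem_cons, List.not_mem_nil, or_false] at hwb
      rcases hwb with rfl | rfl
      · rfl
      · exact huv.symm
    · exact hps b hb w hwb
  set T : Multiset (Gns n s) := (([u, v] :: ps').flatten : Multiset (Gns n s)) with hTdef
  have hTc : T.card + 2 = n := by simpa using hcard
  have huT : u ∈ T := by rw [hTdef]; simp
  have hTτ : ∀ w ∈ T, h.toKlein w = τ := fun w hw => hflat w (Multiset.mem_coe.1 hw)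
  have hTS : T ≤ T + {r₁, r₂} := Multiset.le_add_right _ _
  have hTu := eq_replicate_of_pairs (fun a b hab =>
    h.eq_of_same_image hS hTS (by omega) hTτ hab) huT
  have hord : orderOf u = n := orderOf_eq_of_replicate_le hn hS (k := T.card) (by omega)
    (hTu ▸ hTS) (h.pow_eq_one u)
  obtain ⟨α, hα⟩ := h.exists_isPresentedBy hs1 hord
  -- A leftover term with the image of the pairs joins the `n - 2` equal terms and makes `n - 1` of
  -- them.
  have hextra : ∀ r r', T + {r₁, r₂} = T + {r} + {r'} → h.toKlein r = τ →
      IsExtremal n s (T + {r₁, r₂}) := by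
    intro r r' hrr hr
    rw [hrr] at hS ⊢
    have hT' := eq_replicate_of_pairs (S := T + {r}) (fun a b hab =>
      h.eq_of_same_image hS (Multiset.le_add_right _ _) (by simp; omega) (by
        intro g hg
        rcases Multiset.mem_add.1 hg with hg | hg
        · exact hTτ g hg
        · rw [Multiset.mem_singleton.1 hg, hr]) hab) (Multiset.mem_add.2 (Or.inl huT))
    have hc' : (T + {r}).card = n - 1 := by simp; omega
    rw [hc'] at hT'
    rw [hT'] at hS ⊢
    exact hα.isExtremal (by omega) h.sq hS
  by_cases h1 : h.toKlein r₁ = τ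
  · exact hextra r₁ r₂ (by rw [add_assoc]; rfl) h1
  by_cases h2 : h.toKlein r₂ = τ
  · exact hextra r₂ r₁ (by rw [add_assoc, Multiset.pair_comm]; rfl) h2
  exfalso
  have hout : ∀ r, h.toKlein r ≠ 1 → h.toKlein r ≠ τ → r ∉ Subgroup.zpowers u := by
    rintro r hr1 hrτ ⟨j, rfl⟩
    change h.toKlein (u ^ j) ≠ 1 at hr1
    change h.toKlein (u ^ j) ≠ τ at hrτ
    rw [map_zpow, ← hτ] at hr1 hrτ
    have hτ2 : τ ^ (2 : ℤ) = 1 := by rw [zpow_two, klein_mul_self]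
    rcases Int.even_or_odd' j with ⟨m, rfl | rfl⟩
    · exact hr1 (by rw [zpow_mul, hτ2, one_zpow])
    · exact hrτ (by rw [zpow_add_one, zpow_mul, hτ2, one_zpow, one_mul])
  refine hα.not_productOneFree hn h.sq hs1 hs2 (hout r₁ hr1 h1) (hout r₂ hr2 h2)
    (k := T.card) (by omega) ?_
  rw [← hTu]
  exact hS

/-- Product-one free sequences of length `n` over `G_{n,s}` are extremal. -/
theorem ProductOneFree.isExtremal (hn : 8 ≤ n) (hs : s ^ 2 ≡ 1 [ZMOD n])
    (hs1 : ¬ s ≡ 1 [ZMOD n]) (hs2 : ¬ s ≡ -1 [ZMOD n]) {S : Multiset (Gns n s)}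
    (hS : ProductOneFree S) (hcard : S.card = n) : IsExtremal n s S := by
  classical
  obtain ⟨q, κ, hqκ, hq, hκ, hqs, t, ht, hcop⟩ := exists_factorization (by omega) hs hs1 hs2
  rcases hq.eq_or_lt with rfl | hq3
  · have htodd : Odd t := by
      rw [← Int.not_even_iff_odd, even_iff_two_dvd]
      intro h2
      have := hcop.isUnit_of_dvd' (x := 2) (by norm_num) h2
      rw [Int.isUnit_iff] at this
      omega
    have hκe : Even κ := by
      have he : Even ((κ : ℤ) * t) := by
        rw [← ht, even_iff_two_dvd]
        push_cast at hqs
        omega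
      rw [Int.even_mul] at he
      rcases he with he | he
      · exact_mod_cast he
      · exact absurd he (Int.not_even_iff_odd.2 htodd)
    exact IsHalfTwist.isExtremal ⟨hqκ, hn, hs, ⟨t, ht, htodd⟩, hκe⟩ hs1 hs2 hS hcard
  · by_cases hF : (S.filter (· ∉ Subgroup.zpowers (genY n s))).card ≤ 1
    · exact isExtremal_of_few_reflections hn hs hs1 hS hcard hF
    · exfalso
      have hsplit := Multiset.filter_add_not (· ∈ Subgroup.zpowers (genY n s)) S
      refine false_of_many_reflections hn hs hs1 hs2 hqκ hq3 hκ hqs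
        (R := S.filter (· ∈ Subgroup.zpowers (genY n s)))
        (F := S.filter (· ∉ Subgroup.zpowers (genY n s))) (by rwa [hsplit])
        (by rw [← Multiset.card_add, hsplit, hcard])
        (fun g hg => (Multiset.mem_filter.1 hg).2) (fun g hg => (Multiset.mem_filter.1 hg).2)
        (by omega)

/-- A product that uses `γ` once lies outside `⟨β⟩`; one that omits it is `β ^ j` with `0 < j < n`.
-/
theorem productOneFree_replicate_add_singleton (hn : 0 < n)
    {β γ : Gns n s} (hβ : orderOf β = n) (hγ : γ ∉ Subgroup.zpowers β) :
    ProductOneFree (Multiset.replicate (n - 1) β + {γ}) := by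
  intro l h0 hl h1
  rw [add_comm, Multiset.singleton_add] at hl
  have hmem : ∀ l' : List (Gns n s), (l' : Multiset (Gns n s)) ≤ Multiset.replicate (n - 1) β →
      l'.prod ∈ Subgroup.zpowers β := fun l' hl' => Subgroup.list_prod_mem _ fun g hg => by
    rw [Multiset.eq_of_mem_replicate (Multiset.mem_of_le hl' (Multiset.mem_coe.2 hg))]
    exact Subgroup.mem_zpowers β
  by_cases hg : γ ∈ l
  · obtain ⟨l₁, l₂, rfl⟩ := List.append_of_mem hg
    have hle : ((l₁ ++ l₂ : List _) : Multiset (Gns n s)) ≤ Multiset.replicate (n - 1) β := by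
      rw [← Multiset.coe_add, ← Multiset.cons_coe, Multiset.add_cons,
        Multiset.cons_le_cons_iff, Multiset.coe_add] at hl
      exact hl
    have m₁ := hmem l₁ ((coe_le_coe_of_sublist (List.sublist_append_left _ _)).trans hle)
    have m₂ := hmem l₂ ((coe_le_coe_of_sublist (List.sublist_append_right _ _)).trans hle)
    rw [List.prod_append, List.prod_cons] at h1
    refine hγ ?_
    have := Subgroup.one_mem (Subgroup.zpowers β)
    rw [← h1, Subgroup.mul_mem_cancel_left _ m₁, Subgroup.mul_mem_cancel_right _ m₂] at this
    exact this
  · rw [Multiset.le_cons_of_notMem (by simpa using hg)] at hl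
    have hlr : l = List.replicate l.length β := List.eq_replicate_of_mem fun b hb =>
      Multiset.eq_of_mem_replicate (Multiset.mem_of_le hl (Multiset.mem_coe.2 hb))
    have hlen : l.length ≤ n - 1 := by simpa using Multiset.card_le_card hl
    rw [hlr, List.prod_replicate] at h1
    have := Nat.le_of_dvd (List.length_pos_iff.2 h0) (orderOf_dvd_of_pow_eq_one h1)
    omega

theorem IsExtremal.productOneFree (hn : 0 < n) (hs : s ^ 2 ≡ 1 [ZMOD n])
    (hs1 : ¬ s ≡ 1 [ZMOD n]) {S : Multiset (Gns n s)} (hS : IsExtremal n s S) :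
    ProductOneFree S := by
  obtain ⟨α, β, h, t, -, rfl⟩ := hS
  refine productOneFree_replicate_add_singleton hn (h.orderOf_eq hs) ?_
  simpa using h.mul_zpow_notMem hs hs1 t

theorem IsExtremal.count (hs : s ^ 2 ≡ 1 [ZMOD n]) (hs1 : ¬ s ≡ 1 [ZMOD n])
    {S : Multiset (Gns n s)} [DecidableEq (Gns n s)] (hS : IsExtremal n s S) (g : Gns n s) :
    S.count g = n - 1 ∨ S.count g ≤ 1 := by
  obtain ⟨α, β, h, t, -, rfl⟩ := hS
  have hγ := h.mul_zpow_notMem hs hs1 t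
  rw [zpow_natCast] at hγ
  rw [Multiset.count_add, Multiset.count_replicate, Multiset.count_singleton]
  by_cases hg : β = g
  · subst hg
    rw [if_pos rfl, if_neg (fun he => hγ (by rw [← he]; exact Subgroup.mem_zpowers β))]
    left; rfl
  · rw [if_neg hg]
    right
    split <;> omega

theorem le_exponent (hn : 0 < n) (hs : s ^ 2 ≡ 1 [ZMOD n]) :
    n ≤ Monoid.exponent (Gns n s) := by
  have := finite_Gns (s := s) hn
  have h := Monoid.order_dvd_exponent (genY n s)
  rw [orderOf_genY hs] at h
  exact Nat.le_of_dvd (Nat.pos_of_ne_zero Monoid.exponent_ne_zero_of_finite) h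

theorem ProductOneFree.not_hasShort {G : Type*} [Group G] {S : Multiset G}
    (hS : ProductOneFree S) : ¬ HasShortProductOneSubseq S := by
  rintro ⟨T, hT, ⟨l, rfl, hl⟩, hc, -⟩
  refine hS l ?_ hT hl
  rintro rfl
  simp at hc

theorem productOneFree_of_not_hasShort {G : Type*} [Group G] {S : Multiset G}
    (hc : S.card ≤ Monoid.exponent G) (hS : ¬ HasShortProductOneSubseq S) :
    ProductOneFree S := by
  intro l h0 hl h1
  refine hS ⟨l, hl, ⟨l, rfl, h1⟩, ?_, (Multiset.card_le_card hl).trans hc⟩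
  simpa [Nat.one_le_iff_ne_zero] using h0

theorem exists_isExtremal : ∃ S : Multiset (Gns n s), IsExtremal n s S :=
  ⟨_, genX n s, genY n s, isPresentedBy_gen, 0, Nat.zero_le _, rfl⟩

theorem IsExtremal.card_eq (hn : 0 < n) {S : Multiset (Gns n s)} (hS : IsExtremal n s S) :
    S.card = n := by
  obtain ⟨α, β, -, t, -, rfl⟩ := hS
  simp
  omega

/-- Add a further term `g` to an extremal sequence. If `g = β` there are `n` copies of `β`;
otherwise, trading one `β` for `g` leaves `n - 2` copies. Neither multiplicity occurs in an extremal
sequence. -/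
theorem hasShort_of_lt_card (hn : 8 ≤ n) (hs : s ^ 2 ≡ 1 [ZMOD n])
    (hs1 : ¬ s ≡ 1 [ZMOD n]) (hs2 : ¬ s ≡ -1 [ZMOD n]) {S : Multiset (Gns n s)}
    (hS : n + 1 ≤ S.card) : HasShortProductOneSubseq S := by
  classical
  by_contra hno
  have hext : ∀ T ≤ S, T.card = n → IsExtremal n s T := fun T hT hTc =>
    ProductOneFree.isExtremal hn hs hs1 hs2 (productOneFree_of_not_hasShort
      (by rw [hTc]; exact le_exponent (by omega) hs)
      (fun ⟨U, hU, hU'⟩ => hno ⟨U, hU.trans hT, hU'⟩)) hTc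
  obtain ⟨T, hT, hTc⟩ := exists_le_card_eq hS
  obtain ⟨g, hg⟩ := Multiset.card_pos_iff_exists_mem.1 (show 0 < T.card by omega)
  obtain ⟨U, rfl⟩ := Multiset.exists_cons_of_mem hg
  rw [Multiset.card_cons] at hTc
  obtain ⟨α, β, h, t, -, rfl⟩ := hext U ((Multiset.le_cons_self _ _).trans hT) (by omega)
  set γ := α * β ^ t with hγdef
  have hγ : β ≠ γ := by
    intro hβ
    have := h.mul_zpow_notMem hs hs1 t
    rw [zpow_natCast, ← hγdef, ← hβ] at this
    exact this (Subgroup.mem_zpowers β)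
  by_cases hgβ : g = β
  · subst hgβ
    have hle : Multiset.replicate n g ≤ g ::ₘ (Multiset.replicate (n - 1) g + {γ}) := by
      rw [← Multiset.cons_add, ← Multiset.replicate_succ, Nat.sub_add_cancel (by omega)]
      exact Multiset.le_add_right _ _
    have := (hext _ (hle.trans hT) (by simp)).count hs hs1 g
    rw [Multiset.count_replicate_self] at this
    omega
  · have hle : g ::ₘ (Multiset.replicate (n - 2) β + {γ}) ≤
        g ::ₘ (Multiset.replicate (n - 1) β + {γ}) := by
      refine Multiset.cons_le_cons _ (add_le_add_left (Multiset.replicate_mono _ (by omega)) _)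
    have := (hext _ (hle.trans hT) (by simp; omega)).count hs hs1 β
    rw [Multiset.count_cons_of_ne (Ne.symm hgβ), Multiset.count_add,
      Multiset.count_replicate_self, Multiset.count_singleton, if_neg hγ] at this
    omega

end Inverse

end ZeroSum

theorem theorem1p3 (n : ℕ) (hn : 8 ≤ n) (s : ℤ) (hs : s ^ 2 ≡ 1 [ZMOD n])
    (hs1 : ¬ s ≡ 1 [ZMOD n]) (hs2 : ¬ s ≡ -1 [ZMOD n]) :
    ZeroSum.eta (ZeroSum.Gns n s) = n + 1 ∧
    ∀ S : Multiset (ZeroSum.Gns n s), Multiset.card S = n →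
      (¬ ZeroSum.HasShortProductOneSubseq S ↔
        ∃ α β : ZeroSum.Gns n s, ZeroSum.IsPresentedBy n s α β ∧
          ∃ t : ℕ, t ≤ n - 1 ∧
            S = Multiset.replicate (n - 1) β + {α * β ^ t}) := by
  have hn0 : 0 < n := by omega
  refine ⟨le_antisymm (Nat.sInf_le ⟨Nat.succ_pos n, fun S hS =>
    ZeroSum.hasShort_of_lt_card hn hs hs1 hs2 hS⟩) ?_, fun S hS => ⟨fun h => ?_, fun h => ?_⟩⟩
  · refine le_csInf ⟨n + 1, Nat.succ_pos n, fun S hS =>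
      ZeroSum.hasShort_of_lt_card hn hs hs1 hs2 hS⟩ fun ℓ ⟨_, hℓ⟩ => ?_
    by_contra hlt
    obtain ⟨S, hS⟩ := ZeroSum.exists_isExtremal (n := n) (s := s)
    exact (hS.productOneFree hn0 hs hs1).not_hasShort (hℓ S (by rw [hS.card_eq hn0]; omega))
  · exact (ZeroSum.productOneFree_of_not_hasShort
      (by rw [hS]; exact ZeroSum.le_exponent hn0 hs) h).isExtremal hn hs hs1 hs2 hS
  · exact (ZeroSum.IsExtremal.productOneFree hn0 hs hs1 h).not_hasShort
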